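/- Graphs are finite; multigraphs may have parallel edges, so that two parallel edges form a cycle of length $2$. Let $k\in\{1,2,3\}$ and let $G$ be a simple graph with $n$ vertices and $2(n-1)-k$ edges. Let $c:E(G)\to\{1,\dots,n-1\}$ be an edge colouring (not necessarily proper) such that every colour is used on at most two edges, such that $G$ contains no rainbow cycle (a cycle whose edges have pairwise distinct colours), and such that exactly $k$ edges of $G$ are colour-singular, that is, share their colour with no other edge of $G$; let $A$ be the set of these $k$ edges. Let $x_1,x_2,x_3$ be distinct vertices of $G$, and let $G'$ be the multigraph obtained from $G$ by adding three new edges $e_1=x_1x_2$, $e_2=x_2x_3$, $e_3=x_3x_1$ (which may be parallel to edges of $G$). Put $T=\{e_1,e_2,e_3\}$ and extend $c$ to a colouring $c'$ of $G'$ by $c'(e_1)=c'(e_2)=c'(e_3)=n$. Suppose that the subgraph of $G'$ formed by the edges in $T\cup A$ and their endvertices is not isomorphic to $K_4$. Then $G'$ contains two edge-disjoint cycles $C_1,C_2$, each rainbow with respect to $c'$, such that $|E(C_1)\cap T|=|E(C_2)\cap T|=1$ and $|E(C_1)|+|E(C_2)|\le n+2$. -/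

import Mathlib

namespace Graph

variable {α β κ : Type*}

/-- `C` is the edge set of a cycle of the multigraph `G`: there are distinct vertices
`v 0, …, v m` and distinct edges `e 0, …, e m` such that `e i` joins `v i` to `v (i + 1)`, where
indices are taken modulo `m + 1`, and `C = {e 0, …, e m}`. In particular a loop is a cycle with one
edge and a pair of parallel edges is a cycle with two edges. -/
def IsCycleEdgeSet (G : Graph α β) (C : Set β) : Prop :=
  ∃ (m : ℕ) (v : Fin (m + 1) → α) (e : Fin (m + 1) → β),
    Function.Injective v ∧ Function.Injective e ∧
      (∀ i, G.IsLink (e i) (v i) (v (i + 1))) ∧ C = Set.range e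

/-- `C` is the edge set of a rainbow cycle: a cycle whose edges have pairwise distinct colours. -/
def IsRainbowCycle (G : Graph α β) (c : β → κ) (C : Set β) : Prop :=
  G.IsCycleEdgeSet C ∧ Set.InjOn c C

/-- The coloured graph `(G, c)` has no rainbow cycle. -/
def CircuitAchromatic (G : Graph α β) (c : β → κ) : Prop :=
  ∀ C : Set β, ¬ G.IsRainbowCycle c C

/-- The edges of `G` are coloured with colours from `{1, …, k}`. (Only the values of `c` on the
edges of `G` matter.) -/
def IsEdgeColouring (G : Graph α β) (k : ℕ) (c : β → ℕ) : Prop :=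
  Set.MapsTo c G.edgeSet (Set.Icc 1 k)

/-- Every colour class of `(G, c)` has at most `b` elements. -/
def IsBoundedColouring (G : Graph α β) (b : ℕ) (c : β → κ) : Prop :=
  ∀ s : κ, {e | e ∈ G.edgeSet ∧ c e = s}.encard ≤ b

/-- The colour-singular edges of `(G, c)`: those which are alone in their colour class. -/
def colourSingularEdges (G : Graph α β) (c : β → κ) : Set β :=
  {e | e ∈ G.edgeSet ∧ ∀ f ∈ G.edgeSet, c f = c e → f = e}

/-- The subgraph of `G` induced by the edge set `F`: its edges are the edges of `G` in `F`, its
vertices are their ends. -/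
def edgeInduce (G : Graph α β) (F : Set β) : Graph α β where
  vertexSet := {x | ∃ e ∈ F, G.Inc e x}
  IsLink e x y := e ∈ F ∧ G.IsLink e x y
  isLink_symm := fun _ _ => ⟨fun _ _ h => ⟨h.1, h.2.symm⟩⟩
  eq_or_eq_of_isLink_of_isLink := fun _ _ _ _ _ h h' => h.2.left_eq_or_eq h'.2
  left_mem_of_isLink := fun e _ _ h => ⟨e, h.1, h.2.inc_left⟩

/-- `G` is isomorphic to the complete graph `K₄`. -/
def IsKFour (G : Graph α β) : Prop :=
  G.Simple ∧ Nonempty (G.toSimpleGraph ≃g (⊤ : SimpleGraph (Fin 4)))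

/-- The multigraph obtained from `G` by adding three new edges `Sum.inr 0`, `Sum.inr 1`,
`Sum.inr 2`, which join `x 0` to `x 1`, `x 1` to `x 2` and `x 2` to `x 0`. The new edges may be
parallel to edges `Sum.inl e` coming from `G`. -/
def addTriangle (G : Graph α β) (x : Fin 3 → α) : Graph α (β ⊕ Fin 3) where
  vertexSet := G.vertexSet ∪ Set.range x
  IsLink e u w := Sum.elim (fun f => G.IsLink f u w) (fun i => s(u, w) = s(x i, x (i + 1))) e
  isLink_symm := by
    rintro (f | i) -
    · exact ⟨fun _ _ h => IsLink.symm h⟩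
    · exact ⟨fun u w h => (Sym2.eq_swap (a := w) (b := u)).trans h⟩
  eq_or_eq_of_isLink_of_isLink := by
    rintro (f | i) u w u' w' h h'
    · exact IsLink.left_eq_or_eq h h'
    · have hh : s(u, w) = s(u', w') := Eq.trans h (Eq.symm h')
      have hu : u ∈ s(u', w') := hh ▸ Sym2.mem_mk_left u w
      exact Sym2.mem_iff.mp hu
  left_mem_of_isLink := by
    rintro (f | i) u w h
    · exact Or.inl (IsLink.left_mem h)
    · have hh : s(u, w) = s(x i, x (i + 1)) := h
      have hu : u ∈ s(x i, x (i + 1)) := hh ▸ Sym2.mem_mk_left u w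
      rcases Sym2.mem_iff.mp hu with rfl | rfl
      · exact Or.inr ⟨i, rfl⟩
      · exact Or.inr ⟨i + 1, rfl⟩

/-- The three edges of the added triangle. -/
def triangleEdges (β : Type*) : Set (β ⊕ Fin 3) := Set.range Sum.inr

/-- The colouring which extends `c` by giving the colour `s` to the three added edges. -/
def extendColouring (c : β → κ) (s : κ) : β ⊕ Fin 3 → κ := Sum.elim c (fun _ => s)

end Graph

set_option linter.unusedSectionVars false

/-! Counting edges against colour classes shows that all `n - 1` colours occur. Rainbow edge sets
are forests, so one edge of each colour makes a spanning tree. The structural core is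
`exists_isMonochromaticCut`: some vertex partition is crossed by a single colour. In a smallest
counterexample, contracting an edge `e` and dropping its colour yields a cut; contracting the side
away from `e` shows that this side is one vertex `y`, whose edges are the colour partner of `e` and
all edges of one other colour. Different partners get different vertices `y`, so there are at most
`n` edges, whereas each of the `n - 1` colours lies on two edges; this is impossible for `n ≥ 3`.

Cutting recursively (`exists_cluster`) builds `G` from single vertices by merges, each along one
colour-singular edge or along two edges of a common new colour. The rank counts merges of the first
kind; by `Cluster.card_edges` it equals `k ≤ 3`.

The two cycles come from edge-disjoint rainbow connections in `G` from one `x i` to the other two,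
with at most `n` edges in total, each closed by an edge of `T`. They are found by induction over
merges, with the `x i` generalised to pairs of vertices: a single vertex merged along two edges to
`a ≠ a'` can be traded for the pair `{a, a'}`. Ranks one, two and three are treated by
`Cluster.linkOne`, `Cluster.linkTwo` and `Cluster.linkThree`, each falling back on the earlier ones
when a side has smaller rank. The only obstruction is a configuration of singular edges, at rank
three a star from some `o` to all the `x i`. Then the star is the whole of `A`, and together with
`T` it is the excluded `K₄`. -/

namespace RainbowLinkage

/-! ### Forests, rainbow edge sets and contraction -/

variable {α β κ : Type*}

/-- `u` and `v` are connected by edges from `F`, where `ε e` is the pair of ends of `e`. -/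
def Conn (ε : β → Sym2 α) (F : Finset β) : α → α → Prop :=
  Relation.ReflTransGen fun a b => ∃ e ∈ F, ε e = s(a, b)

theorem Conn.refl {ε : β → Sym2 α} {F : Finset β} (u : α) : Conn ε F u u :=
  Relation.ReflTransGen.refl

theorem Conn.trans {ε : β → Sym2 α} {F : Finset β} {u v w : α} (h : Conn ε F u v)
    (h' : Conn ε F v w) : Conn ε F u w :=
  Relation.ReflTransGen.trans h h'

theorem Conn.symm {ε : β → Sym2 α} {F : Finset β} {u v : α} (h : Conn ε F u v) :
    Conn ε F v u := by
  induction h with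
  | refl => exact Conn.refl _
  | tail _ hbc ih =>
    obtain ⟨e, he, hε⟩ := hbc
    exact Relation.ReflTransGen.head ⟨e, he, hε.trans Sym2.eq_swap⟩ ih

theorem Conn.mono {ε : β → Sym2 α} {F F' : Finset β} {u v : α} (h : Conn ε F u v)
    (hF : F ⊆ F') : Conn ε F' u v :=
  Relation.ReflTransGen.mono (fun _ _ ⟨e, he, h⟩ => ⟨e, hF he, h⟩) _ _ h

theorem Conn.edge {ε : β → Sym2 α} {F : Finset β} {e : β} {u v : α} (he : e ∈ F)
    (h : ε e = s(u, v)) : Conn ε F u v :=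
  Relation.ReflTransGen.single ⟨e, he, h⟩

variable [DecidableEq α] [DecidableEq β] [DecidableEq κ]

/-- No edge of `F` has its ends connected by the other edges of `F`. -/
def Forest (ε : β → Sym2 α) (F : Finset β) : Prop :=
  ∀ e ∈ F, ∀ u v, ε e = s(u, v) → ¬ Conn ε (F.erase e) u v

theorem Forest.subset {ε : β → Sym2 α} {F F' : Finset β} (h : Forest ε F) (hF : F' ⊆ F) :
    Forest ε F' := fun e he u v huv hc =>
  h e (hF he) u v huv (hc.mono (Finset.erase_subset_erase e hF))

/-- Adding edges one at a time and redirecting one class to another merges exactly two classes per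
edge, since acyclicity keeps the ends of a new edge in different classes. Hence vertices equal
classes plus edges. -/
theorem Forest.exists_representatives {ε : β → Sym2 α} {F : Finset β} (hF : Forest ε F)
    {Y : Finset α} (hY : ∀ e ∈ F, ∀ v ∈ ε e, v ∈ Y) :
    ∃ r : α → α, (∀ u ∈ Y, ∀ v ∈ Y, r u = r v → Conn ε F u v) ∧
      (Y.image r).card + F.card = Y.card := by
  induction F using Finset.induction_on with
  | empty => exact ⟨id, fun u _ v _ h => by cases h; exact Conn.refl _, by simp⟩
  | insert e F he ih =>
    obtain ⟨r, hr, hcard⟩ := ih (hF.subset (Finset.subset_insert e F))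
      fun f hf => hY f (Finset.mem_insert_of_mem hf)
    obtain ⟨a, b, hab⟩ : ∃ a b, ε e = s(a, b) := by
      induction h : ε e with | h a b => exact ⟨a, b, rfl⟩
    have ha : a ∈ Y := hY e (Finset.mem_insert_self e F) a (by simp [hab])
    have hb : b ∈ Y := hY e (Finset.mem_insert_self e F) b (by simp [hab])
    have hne : r a ≠ r b := fun h => by
      refine hF e (Finset.mem_insert_self e F) a b hab ?_
      rw [Finset.erase_insert he]
      exact hr a ha b hb h
    have hc : Conn ε (insert e F) a b := Conn.edge (Finset.mem_insert_self e F) hab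
    have hr' : ∀ u ∈ Y, ∀ v ∈ Y, r u = r v → Conn ε (insert e F) u v := fun u hu v hv h =>
      (hr u hu v hv h).mono (Finset.subset_insert e F)
    refine ⟨fun u => if r u = r b then r a else r u, ?_, ?_⟩
    · intro u hu v hv h
      dsimp only at h
      split_ifs at h with h1 h2 h2
      · exact hr' u hu v hv (h1.trans h2.symm)
      · exact ((hr' u hu b hb h1).trans hc.symm).trans (hr' a ha v hv h)
      · exact ((hr' u hu a ha h).trans hc).trans (hr' b hb v hv h2.symm)
      · exact hr' u hu v hv h
    · have himg : Y.image (fun u => if r u = r b then r a else r u) = (Y.image r).erase (r b) := by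
        ext x
        simp only [Finset.mem_image, Finset.mem_erase]
        constructor
        · rintro ⟨u, hu, rfl⟩
          split_ifs with h
          · exact ⟨hne, a, ha, rfl⟩
          · exact ⟨h, u, hu, rfl⟩
        · rintro ⟨hx, u, hu, rfl⟩
          exact ⟨u, hu, by rw [if_neg hx]⟩
      have hmem : r b ∈ Y.image r := Finset.mem_image_of_mem r hb
      have := Finset.card_pos.mpr ⟨_, hmem⟩
      rw [himg, Finset.card_erase_of_mem hmem, Finset.card_insert_of_notMem he]
      omega

theorem Forest.card_lt {ε : β → Sym2 α} {F : Finset β} (hF : Forest ε F)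
    {Y : Finset α} (hY : ∀ e ∈ F, ∀ v ∈ ε e, v ∈ Y) (hne : Y.Nonempty) :
    F.card + 1 ≤ Y.card := by
  obtain ⟨r, -, hr⟩ := hF.exists_representatives hY
  have := Finset.card_pos.mpr (hne.image r)
  omega

theorem Forest.conn {ε : β → Sym2 α} {F : Finset β} (hF : Forest ε F)
    {Y : Finset α} (hY : ∀ e ∈ F, ∀ v ∈ ε e, v ∈ Y) (hcard : F.card + 1 = Y.card)
    {u v : α} (hu : u ∈ Y) (hv : v ∈ Y) : Conn ε F u v := by
  obtain ⟨r, hr, h⟩ := hF.exists_representatives hY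
  have h1 : (Y.image r).card ≤ 1 := by omega
  exact hr u hu v hv (Finset.card_le_one.mp h1 _ (Finset.mem_image_of_mem r hu) _
    (Finset.mem_image_of_mem r hv))

theorem exists_transversal (c : β → κ) (E : Finset β) :
    ∃ K ⊆ E, Set.InjOn c K ∧ K.image c = E.image c := by
  obtain ⟨K, hK, hinj, himg⟩ := Finset.exists_subset_injOn_image_eq_of_surjOn (f := c)
    (E : Set β) (E.image c) (by intro x hx; simpa using hx)
  exact ⟨K, by exact_mod_cast hK, hinj, himg⟩

/-- Every set of edges with pairwise distinct colours is a forest. -/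
def RainbowAcyclic (ε : β → Sym2 α) (c : β → κ) (E : Finset β) : Prop :=
  ∀ F ⊆ E, Set.InjOn c F → Forest ε F

theorem RainbowAcyclic.subset {ε : β → Sym2 α} {c : β → κ} {E E' : Finset β}
    (h : RainbowAcyclic ε c E) (hE : E' ⊆ E) : RainbowAcyclic ε c E' :=
  fun F hF => h F (hF.trans hE)

theorem RainbowAcyclic.card_lt {ε : β → Sym2 α} {c : β → κ} {E : Finset β}
    (h : RainbowAcyclic ε c E) {Y : Finset α} (hY : ∀ e ∈ E, ∀ v ∈ ε e, v ∈ Y)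
    (hne : Y.Nonempty) : (E.image c).card + 1 ≤ Y.card := by
  obtain ⟨K, hK, hinj, himg⟩ := exists_transversal c E
  rw [← himg, Finset.card_image_of_injOn hinj]
  exact (h K hK hinj).card_lt (fun e he => hY e (hK he)) hne

theorem RainbowAcyclic.exists_spanning {ε : β → Sym2 α} {c : β → κ} {E : Finset β}
    (h : RainbowAcyclic ε c E) {Y : Finset α} (hY : ∀ e ∈ E, ∀ v ∈ ε e, v ∈ Y)
    (hcard : (E.image c).card + 1 = Y.card) :
    ∃ K ⊆ E, Set.InjOn c K ∧ ∀ u ∈ Y, ∀ v ∈ Y, Conn ε K u v := by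
  obtain ⟨K, hK, hinj, himg⟩ := exists_transversal c E
  rw [← himg, Finset.card_image_of_injOn hinj] at hcard
  exact ⟨K, hK, hinj, fun u hu v hv =>
    (h K hK hinj).conn (fun e he => hY e (hK he)) hcard hu hv⟩

/-- Consecutive edges of a walk in the contraction meet only after applying `r`; connections inside
`K` bridge the gaps. -/
theorem Conn.lift {ε : β → Sym2 α} {F K : Finset β} {r : α → α}
    (hr : ∀ a b, r a = r b → Conn ε K a b) {u v : α}
    (h : Conn (fun e => (ε e).map r) F u v) :
    ∀ a b, r a = u → r b = v → Conn ε (F ∪ K) a b := by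
  have hrF : ∀ a b, r a = r b → Conn ε (F ∪ K) a b := fun a b hab =>
    (hr a b hab).mono Finset.subset_union_right
  induction h with
  | refl => exact fun a b ha hb => hrF a b (ha.trans hb.symm)
  | @tail x y _ hxy ih =>
    intro a b ha hb
    obtain ⟨e, he, hxy⟩ := hxy
    obtain ⟨p, q, hpq⟩ : ∃ p q, ε e = s(p, q) := by
      induction h : ε e with | h p q => exact ⟨p, q, rfl⟩
    have hc : Conn ε (F ∪ K) p q := Conn.edge (Finset.mem_union_left _ he) hpq
    dsimp only at hxy
    rw [hpq, Sym2.map_mk, Sym2.eq_iff] at hxy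
    rcases hxy with ⟨hp, hq⟩ | ⟨hp, hq⟩
    · exact ((ih a p ha hp).trans hc).trans (hrF q b (hq.trans hb.symm))
    · exact ((ih a q ha hq).trans hc.symm).trans (hrF p b (hp.trans hb.symm))

/-- A rainbow cycle of the contraction closes up through `K` before contraction, and it stays
rainbow because `K` is rainbow and shares no colour with `E'`. -/
theorem RainbowAcyclic.contract {ε : β → Sym2 α} {c : β → κ} {E E' K : Finset β}
    (h : RainbowAcyclic ε c E) {r : α → α} (hE' : E' ⊆ E) (hK : K ⊆ E) (hinj : Set.InjOn c K)
    (hcol : ∀ e ∈ E', ∀ f ∈ K, c e ≠ c f) (hr : ∀ a b, r a = r b → Conn ε K a b) :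
    RainbowAcyclic (fun e => (ε e).map r) c E' := by
  intro F hF hFinj e he u v huv hc
  obtain ⟨a, b, hab⟩ : ∃ a b, ε e = s(a, b) := by
    induction h : ε e with | h p q => exact ⟨p, q, rfl⟩
  have hc' : Conn ε (F.erase e ∪ K) a b := by
    dsimp only at huv
    rw [hab, Sym2.map_mk, Sym2.eq_iff] at huv
    rcases huv with ⟨ha, hb⟩ | ⟨ha, hb⟩
    · exact hc.lift hr a b ha hb
    · exact (hc.lift hr b a hb ha).symm
  refine h (F ∪ K) (Finset.union_subset (hF.trans hE') hK) ?_ e (Finset.mem_union_left _ he) a b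
    hab (hc'.mono ?_)
  · intro x hx y hy hxy
    simp only [Finset.coe_union, Set.mem_union, Finset.mem_coe] at hx hy
    rcases hx with hx | hx <;> rcases hy with hy | hy
    · exact hFinj hx hy hxy
    · exact absurd hxy (hcol x (hF hx) y hy)
    · exact absurd hxy.symm (hcol y (hF hy) x hx)
    · exact hinj hx hy hxy
  · intro x hx
    simp only [Finset.mem_union, Finset.mem_erase] at hx ⊢
    rcases hx with hx | hx
    · exact ⟨hx.1, Or.inl hx.2⟩
    · exact ⟨fun hxe => hcol e (hF he) x hx (by rw [hxe]), Or.inr hx⟩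

end RainbowLinkage

/-! ### Monochromatic cuts -/

namespace RainbowLinkage

variable {α β κ : Type*} [DecidableEq α] [DecidableEq β] [DecidableEq κ]

theorem exists_ends (ε : β → Sym2 α) (e : β) : ∃ a b, ε e = s(a, b) := by
  induction h : ε e with | h a b => exact ⟨a, b, rfl⟩

open scoped Classical in
/-- The edges of `E` with both ends in `X`. -/
noncomputable def inside (ε : β → Sym2 α) (E : Finset β) (X : Finset α) : Finset β :=
  E.filter fun e => ∀ v ∈ ε e, v ∈ X

theorem mem_inside {ε : β → Sym2 α} {E : Finset β} {X : Finset α} {e : β} :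
    e ∈ inside ε E X ↔ e ∈ E ∧ ∀ v ∈ ε e, v ∈ X := by
  simp [inside]

theorem inside_subset {ε : β → Sym2 α} {E : Finset β} {X : Finset α} : inside ε E X ⊆ E :=
  fun _ he => (mem_inside.mp he).1

theorem RainbowAcyclic.not_loop {ε : β → Sym2 α} {c : β → κ} {E : Finset β}
    (h : RainbowAcyclic ε c E) {e : β} (he : e ∈ E) {a b : α} (hab : ε e = s(a, b)) : a ≠ b := by
  rintro rfl
  exact h {e} (by simpa using he) (by simp) e (by simp) a a hab (Conn.refl a)

/-- If all but one of `|V| - 1` colours occur inside one of the two sides of a partition of `V`,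
then the colours are distributed over the two sides in the only possible way. -/
theorem RainbowAcyclic.cut_colours {ε : β → Sym2 α} {c : β → κ} {E : Finset β}
    (h : RainbowAcyclic ε c E) {X Y : Finset α} (hXY : Disjoint X Y) (hX : X.Nonempty)
    (hY : Y.Nonempty) (hcard : (E.image c).card + 1 = (X ∪ Y).card) {t : κ}
    (ht : E.image c ⊆ insert t ((inside ε E X).image c ∪ (inside ε E Y).image c)) :
    ((inside ε E X).image c).card + 1 = X.card ∧ ((inside ε E Y).image c).card + 1 = Y.card ∧
      t ∉ (inside ε E X).image c ∧ t ∉ (inside ε E Y).image c ∧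
      Disjoint ((inside ε E X).image c) ((inside ε E Y).image c) ∧ t ∈ E.image c := by
  have hXE : inside ε E X ⊆ E := inside_subset
  have hYE : inside ε E Y ⊆ E := inside_subset
  have h1 := (h.subset hXE).card_lt (fun e he => (mem_inside.mp he).2) hX
  have h2 := (h.subset hYE).card_lt (fun e he => (mem_inside.mp he).2) hY
  rw [Finset.card_union_of_disjoint hXY] at hcard
  have hX' := Finset.image_subset_image (f := c) hXE
  have hY' := Finset.image_subset_image (f := c) hYE
  generalize (inside ε E X).image c = A at *
  generalize (inside ε E Y).image c = B at *
  -- The two sides carry at most `|X| - 1` and `|Y| - 1` colours; with `t` this only just reaches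
  -- the `|X| + |Y| - 1` colours present, so there is no slack anywhere.
  have h3 := Finset.card_le_card ht
  have h4 := Finset.card_insert_le t (A ∪ B)
  have h5 := Finset.card_union_add_card_inter A B
  have htn : t ∉ A ∪ B := fun hm => by
    rw [Finset.insert_eq_of_mem hm] at h3
    omega
  have hdisj : (A ∩ B).card = 0 := by omega
  refine ⟨by omega, by omega, fun hm => htn (Finset.mem_union_left _ hm),
    fun hm => htn (Finset.mem_union_right _ hm),
    Finset.disjoint_iff_inter_eq_empty.mpr (Finset.card_eq_zero.mp hdisj), ?_⟩
  by_contra htE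
  have h6 : E.image c ⊆ A ∪ B := fun x hx => by
    rcases Finset.mem_insert.mp (ht hx) with rfl | hx'
    · exact absurd hx htE
    · exact hx'
  have := Finset.card_le_card h6
  omega

/-- A partition of `V` into `X` and `V \ X` such that only the colour `t` crosses. -/
def IsMonochromaticCut (ε : β → Sym2 α) (c : β → κ) (V : Finset α) (E : Finset β) (X : Finset α)
    (t : κ) : Prop :=
  X ⊆ V ∧ X.Nonempty ∧ (V \ X).Nonempty ∧
    ∀ e ∈ E, c e ≠ t → (∀ v ∈ ε e, v ∈ X) ∨ (∀ v ∈ ε e, v ∈ V \ X)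

theorem IsMonochromaticCut.compl {ε : β → Sym2 α} {c : β → κ} {V : Finset α} {E : Finset β}
    {X : Finset α} {t : κ} (h : IsMonochromaticCut ε c V E X t) :
    IsMonochromaticCut ε c V E (V \ X) t := by
  obtain ⟨h1, h2, h3, h4⟩ := h
  refine ⟨Finset.sdiff_subset, h3, ?_, fun e he het => ?_⟩
  · rwa [Finset.sdiff_sdiff_eq_self h1]
  · rw [Finset.sdiff_sdiff_eq_self h1]
    exact (h4 e he het).symm

/-- The side of the cut that avoids the contracted vertex is unaffected by the contraction, so it
serves as `Z`. Edges of the colour of `e` were deleted and remain uncontrolled. -/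
theorem exists_cut_of_contract_edge {ε : β → Sym2 α} {c : β → κ} {V : Finset α} {E : Finset β}
    (hV : ∀ e ∈ E, ∀ v ∈ ε e, v ∈ V) {e : β} {a b : α}
    {X : Finset α} {t : κ}
    (h : IsMonochromaticCut (fun f => (ε f).map fun v => if v = b then a else v) c (V.erase b)
      (E.filter fun f => c f ≠ c e) X t) :
    ∃ Z ⊆ V, Z.Nonempty ∧ a ∉ Z ∧ b ∉ Z ∧ ∀ f ∈ E, c f ≠ c e → c f ≠ t →
      (∀ v ∈ ε f, v ∈ Z) ∨ (∀ v ∈ ε f, v ∈ V \ Z) := by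
  wlog haX : a ∉ X generalizing X
  · exact this h.compl (by simp only [Finset.mem_sdiff]; tauto)
  obtain ⟨h1, h2, h3, h4⟩ := h
  refine ⟨X, h1.trans (Finset.erase_subset _ _), h2, haX, fun hb => by simpa using h1 hb, ?_⟩
  intro f hf hfe hft
  rcases h4 f (by simp [hf, hfe]) hft with h | h
  · refine Or.inl fun v hv => ?_
    have := h _ (Sym2.mem_map.mpr ⟨v, hv, rfl⟩)
    split_ifs at this with hvb
    · exact absurd this haX
    · exact this
  · refine Or.inr fun v hv => Finset.mem_sdiff.mpr ⟨hV f hf v hv, fun hvX => ?_⟩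
    have hvb : v ≠ b := fun hvb => by simpa [hvb] using h1 hvX
    have := h _ (Sym2.mem_map.mpr ⟨v, hv, rfl⟩)
    rw [if_neg hvb, Finset.mem_sdiff] at this
    exact this.2 hvX

/-- The preimage of `X` is a cut: `Z` lies wholly on one side, so the edges inside it cannot cross.
-/
theorem exists_cut_of_contract_set {ε : β → Sym2 α} {c : β → κ} {V Z : Finset α} {E : Finset β}
    (hV : ∀ e ∈ E, ∀ v ∈ ε e, v ∈ V) {y : α} (hy : y ∈ Z) (hZ : Z ⊆ V) {X : Finset α} {t : κ}
    (h : IsMonochromaticCut (fun f => (ε f).map fun v => if v ∈ Z then y else v) c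
      (insert y (V \ Z)) (E \ inside ε E Z) X t) :
    ∃ X', IsMonochromaticCut ε c V E X' t := by
  obtain ⟨h1, h2, h3, h4⟩ := h
  have hr : ∀ x ∈ insert y (V \ Z), (if x ∈ Z then y else x) = x ∧ x ∈ V := by
    intro x hx
    rcases Finset.mem_insert.mp hx with rfl | hx
    · simp [hy, hZ hy]
    · rw [Finset.mem_sdiff] at hx
      simp [hx]
  refine ⟨V.filter fun v => (if v ∈ Z then y else v) ∈ X, Finset.filter_subset _ _, ?_, ?_, ?_⟩
  · obtain ⟨x, hx⟩ := h2
    exact ⟨x, Finset.mem_filter.mpr ⟨(hr x (h1 hx)).2, by rwa [(hr x (h1 hx)).1]⟩⟩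
  · obtain ⟨x, hx⟩ := h3
    rw [Finset.mem_sdiff] at hx
    refine ⟨x, Finset.mem_sdiff.mpr ⟨(hr x hx.1).2, fun hm => ?_⟩⟩
    rw [Finset.mem_filter, (hr x hx.1).1] at hm
    exact hx.2 hm.2
  · intro f hf hft
    by_cases hfZ : f ∈ inside ε E Z
    · have hfZ' := (mem_inside.mp hfZ).2
      by_cases hyX : y ∈ X
      · refine Or.inl fun v hv => Finset.mem_filter.mpr ⟨hV f hf v hv, ?_⟩
        rwa [if_pos (hfZ' v hv)]
      · refine Or.inr fun v hv => Finset.mem_sdiff.mpr ⟨hV f hf v hv, fun hm => hyX ?_⟩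
        rw [Finset.mem_filter, if_pos (hfZ' v hv)] at hm
        exact hm.2
    · rcases h4 f (Finset.mem_sdiff.mpr ⟨hf, hfZ⟩) hft with h | h
      · exact Or.inl fun v hv => Finset.mem_filter.mpr
          ⟨hV f hf v hv, h _ (Sym2.mem_map.mpr ⟨v, hv, rfl⟩)⟩
      · refine Or.inr fun v hv => Finset.mem_sdiff.mpr ⟨hV f hf v hv, fun hm => ?_⟩
        exact (Finset.mem_sdiff.mp (h _ (Sym2.mem_map.mpr ⟨v, hv, rfl⟩))).2
          (Finset.mem_filter.mp hm).2

/-- The local structure that cannot occur at every edge: apart from `h`, the edges at `y` are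
exactly the edges of some other colour. -/
theorem card_edges_le_of_private_ends {ε : β → Sym2 α} {c : β → κ} {V : Finset α} {E : Finset β}
    (hpartner : ∀ e ∈ E, ∃ g ∈ E, g ≠ e ∧ c g = c e)
    (hprivate : ∀ h ∈ E, ∃ y ∈ V, ∃ t, t ≠ c h ∧ ∀ f ∈ E, y ∈ ε f ↔ f = h ∨ c f = t) :
    E.card ≤ V.card := by
  rcases E.eq_empty_or_nonempty with rfl | ⟨e, he⟩
  · simp
  obtain ⟨y₀, -, t₀, -⟩ := hprivate e he
  have : Nonempty α := ⟨y₀⟩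
  have : Nonempty κ := ⟨t₀⟩
  choose! y hy t ht hf using hprivate
  refine Finset.card_le_card_of_injOn y (fun h hh => hy h hh) ?_
  intro h hh h' hh' hyy
  -- If `h ≠ h'` share `y`, each has the colour assigned to the other. The partner of `h'` then also
  -- lies at `y`, which forces it to have the colour of `h`; so `c h = c h' = t h`, against `t h ≠ c
  -- h`.
  by_contra hne
  have h1 : c h = t h' := by
    have : y h' ∈ ε h := hyy ▸ (hf h hh h hh).mpr (Or.inl rfl)
    exact ((hf h' hh' h hh).mp this).resolve_left hne
  have h2 : c h' = t h := by
    have : y h ∈ ε h' := hyy ▸ (hf h' hh' h' hh').mpr (Or.inl rfl)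
    exact ((hf h hh h' hh').mp this).resolve_left (Ne.symm hne)
  obtain ⟨g, hg, hgne, hgc⟩ := hpartner h' hh'
  have : y h' ∈ ε g := hyy ▸ (hf h hh g hg).mpr (Or.inr (hgc.trans h2))
  rcases (hf h' hh' g hg).mp this with h3 | h3
  · exact hgne h3
  · exact ht h hh (by rw [← h2, ← hgc, h3, h1])

/-- The induction quantifies over `ε` because contraction alters the ends of edges while their
colours stay fixed. -/
theorem exists_isMonochromaticCut (c : β → κ) (n : ℕ) : ∀ (ε : β → Sym2 α) (V : Finset α)
    (E : Finset β), V.card = n → 2 ≤ n → (∀ e ∈ E, ∀ v ∈ ε e, v ∈ V) → RainbowAcyclic ε c E →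
    (E.image c).card + 1 = V.card → (∀ s, (E.filter fun e => c e = s).card ≤ 2) →
    ∃ X t, IsMonochromaticCut ε c V E X t := by
  induction n using Nat.strong_induction_on with
  | _ n ih =>
  intro ε V E hn h2 hV hac hcard hbd
  rcases h2.eq_or_lt with rfl | h3
  · obtain ⟨a, b, hne, rfl⟩ := Finset.card_eq_two.mp hn
    obtain ⟨t, ht⟩ := Finset.card_eq_one.mp (show (E.image c).card = 1 by omega)
    refine ⟨{a}, t, by simp, by simp, ⟨b, by simp [hne.symm]⟩, fun e he het => absurd ?_ het⟩
    simpa [ht] using Finset.mem_image_of_mem c he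
  by_contra! hno
  have hpair : ∀ e ∈ E, ∀ f ∈ E, ∀ g ∈ E, f ≠ e → g ≠ e → c f = c e → c g = c e → f = g := by
    intro e he f hf g hg hfe hge hcf hcg
    by_contra hfg
    have hsub : ({e, f, g} : Finset β) ⊆ E.filter fun x => c x = c e := by
      intro x hx
      simp only [Finset.mem_insert, Finset.mem_singleton] at hx
      rcases hx with rfl | rfl | rfl <;> simp [*]
    have := (Finset.card_le_card hsub).trans (hbd (c e))
    rw [Finset.card_eq_three.mpr ⟨e, f, g, hfe.symm, hge.symm, hfg, rfl⟩] at this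
    omega
  have key : ∀ e ∈ E, ∃ g ∈ E, g ≠ e ∧ c g = c e ∧ ∃ y ∈ V, ∃ t, t ≠ c e ∧
      ∀ f ∈ E, y ∈ ε f ↔ f = g ∨ c f = t := by
    intro e he
    obtain ⟨a, b, hab⟩ := exists_ends ε e
    have hne := hac.not_loop he hab
    have ha : a ∈ V := hV e he a (by simp [hab])
    have hb : b ∈ V := hV e he b (by simp [hab])
    -- Contracting `e = ab` and deleting its colour class loses one vertex and one colour.
    obtain ⟨X, t, hcut⟩ := ih (n - 1) (by omega) (fun f => (ε f).map fun v => if v = b then a else v)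
      (V.erase b) (E.filter fun f => c f ≠ c e) (by rw [Finset.card_erase_of_mem hb]; omega)
      (by omega) (by
        intro f hf v hv
        obtain ⟨w, hw, rfl⟩ := Sym2.mem_map.mp hv
        have := hV f (Finset.mem_filter.mp hf).1 w hw
        split_ifs with hwb
        · exact Finset.mem_erase.mpr ⟨hne, ha⟩
        · exact Finset.mem_erase.mpr ⟨hwb, this⟩)
      (hac.contract (K := {e}) (Finset.filter_subset _ _) (by simpa using he) (by simp)
        (by simp) (by
          have hc : Conn ε {e} a b := Conn.edge (by simp) hab
          intro x y hxy
          split_ifs at hxy with hx hy hy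
          · rw [hx, hy]; exact Conn.refl _
          · rw [hx, ← hxy]; exact hc.symm
          · rw [hy, hxy]; exact hc
          · rw [hxy]; exact Conn.refl _))
      (by
        have : (E.filter fun f => c f ≠ c e).image c = (E.image c).erase (c e) := by
          ext x
          simp only [Finset.mem_image, Finset.mem_filter, Finset.mem_erase]
          constructor
          · rintro ⟨f, hf, rfl⟩
            exact ⟨hf.2, f, hf.1, rfl⟩
          · rintro ⟨hx, f, hf, rfl⟩
            exact ⟨f, ⟨hf, hx⟩, rfl⟩
        rw [this, Finset.card_erase_of_mem (Finset.mem_image_of_mem c he),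
          Finset.card_erase_of_mem hb]
        have := Finset.card_pos.mpr ⟨_, Finset.mem_image_of_mem c he⟩
        omega)
      (fun s => (Finset.card_le_card (Finset.filter_subset_filter _
        (Finset.filter_subset _ _))).trans (hbd s))
    obtain ⟨Z, hZV, hZne, haZ, hbZ, hZ⟩ := exists_cut_of_contract_edge hV hcut
    have heI : e ∈ inside ε E (V \ Z) := by
      refine mem_inside.mpr ⟨he, fun v hv => ?_⟩
      rw [hab, Sym2.mem_iff] at hv
      rcases hv with rfl | rfl <;> simp [*]
    have haVZ : a ∈ V \ Z := by simp [*]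
    have hbVZ : b ∈ V \ Z := by simp [*]
    -- `Z` is not a monochromatic cut before contraction; an offending edge can only have the
    -- deleted colour, so it is the partner of `e`.
    obtain ⟨g, hg, hgt, hgZ, hgVZ⟩ : ∃ g ∈ E, c g ≠ t ∧ ¬ (∀ v ∈ ε g, v ∈ Z) ∧
        ¬ (∀ v ∈ ε g, v ∈ V \ Z) := by
      by_contra! hcon
      refine hno Z t ⟨hZV, hZne, ⟨a, haVZ⟩, fun f hf hft => ?_⟩
      by_contra! hc2
      obtain ⟨⟨v, hv, hvZ⟩, w, hw, hwZ⟩ := hc2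
      exact hwZ (hcon f hf hft ⟨v, hv, hvZ⟩ w hw)
    have hgc : c g = c e := by
      by_contra hgc
      rcases hZ g hg hgc hgt with h | h
      · exact hgZ h
      · exact hgVZ h
    have hge : g ≠ e := fun hge => hgVZ (hge ▸ (mem_inside.mp heI).2)
    have hunion : Z ∪ (V \ Z) = V := Finset.union_sdiff_of_subset hZV
    obtain ⟨hc1, hc2, ht1, ht2, hdisj, -⟩ := hac.cut_colours (X := Z) (Y := V \ Z) (t := t)
      Finset.disjoint_sdiff hZne ⟨a, haVZ⟩ (by rw [hunion]; exact hcard) (by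
        intro x hx
        obtain ⟨f, hf, rfl⟩ := Finset.mem_image.mp hx
        by_cases hft : c f = t
        · exact Finset.mem_insert.mpr (Or.inl hft)
        refine Finset.mem_insert_of_mem (Finset.mem_union.mpr ?_)
        by_cases hfe : c f = c e
        · exact Or.inr (hfe ▸ Finset.mem_image_of_mem c heI)
        rcases hZ f hf hfe hft with h | h
        · exact Or.inl (Finset.mem_image_of_mem c (mem_inside.mpr ⟨hf, h⟩))
        · exact Or.inr (Finset.mem_image_of_mem c (mem_inside.mpr ⟨hf, h⟩)))
    have hZcol : ∀ f ∈ E, f ∉ inside ε E Z → c f ∉ (inside ε E Z).image c := by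
      intro f hf hfZ hm
      by_cases hft : c f = t
      · exact ht1 (hft ▸ hm)
      by_cases hfe : c f = c e
      · exact Finset.disjoint_left.mp hdisj hm (hfe ▸ Finset.mem_image_of_mem c heI)
      rcases hZ f hf hfe hft with h | h
      · exact hfZ (mem_inside.mpr ⟨hf, h⟩)
      · exact Finset.disjoint_left.mp hdisj hm
          (Finset.mem_image_of_mem c (mem_inside.mpr ⟨hf, h⟩))
    have hcardV : Z.card + (V \ Z).card = V.card := by
      rw [← Finset.card_union_of_disjoint Finset.disjoint_sdiff, hunion]
    -- A larger `Z` could be contracted along a rainbow spanning tree, and the cut of the smaller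
    -- graph would pull back.
    have hZ1 : Z.card = 1 := by
      by_contra hZ1
      have hZpos := Finset.card_pos.mpr hZne
      obtain ⟨y, hy⟩ := hZne
      have hVZ2 : 2 ≤ (V \ Z).card := by
        have : ({a, b} : Finset α) ⊆ V \ Z := by
          intro x hx
          simp only [Finset.mem_insert, Finset.mem_singleton] at hx
          rcases hx with rfl | rfl <;> assumption
        have := Finset.card_le_card this
        rwa [Finset.card_pair hne] at this
      have hV'card : (insert y (V \ Z)).card = (V \ Z).card + 1 :=
        Finset.card_insert_of_notMem (by simp [hy])
      obtain ⟨K, hK, hKinj, hKc⟩ := (hac.subset (inside_subset (X := Z))).exists_spanning (fun f hf => (mem_inside.mp hf).2) hc1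
      obtain ⟨X', t', hX'⟩ := ih (insert y (V \ Z)).card (by omega)
        (fun f => (ε f).map fun v => if v ∈ Z then y else v)
        (insert y (V \ Z)) (E \ inside ε E Z) rfl (by omega)
        (by
          intro f hf v hv
          obtain ⟨w, hw, rfl⟩ := Sym2.mem_map.mp hv
          have := hV f (Finset.mem_sdiff.mp hf).1 w hw
          split_ifs with hwZ <;> simp [*])
        (hac.contract (K := K) Finset.sdiff_subset (hK.trans inside_subset) hKinj
          (by
            intro f hf k hk hfk
            rw [Finset.mem_sdiff] at hf
            exact hZcol f hf.1 hf.2 (hfk ▸ Finset.mem_image_of_mem c (hK hk)))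
          (by
            intro x z hxz
            split_ifs at hxz with hx hz hz
            · exact hKc x hx z hz
            · exact absurd (hxz ▸ hy) hz
            · exact absurd (hxz ▸ hy) hx
            · rw [hxz]; exact Conn.refl _))
        (by
          have h4 : (E \ inside ε E Z).image c = E.image c \ (inside ε E Z).image c := by
            ext x
            simp only [Finset.mem_image, Finset.mem_sdiff]
            constructor
            · rintro ⟨f, ⟨hf, hfZ⟩, rfl⟩
              exact ⟨⟨f, hf, rfl⟩, fun hm => hZcol f hf hfZ (Finset.mem_image.mpr hm)⟩
            · rintro ⟨⟨f, hf, rfl⟩, hx⟩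
              exact ⟨f, ⟨hf, fun hm => hx ⟨f, hm, rfl⟩⟩, rfl⟩
          have h5 := Finset.card_sdiff_add_card_eq_card (Finset.image_subset_image (f := c)
            (inside_subset (ε := ε) (E := E) (X := Z)))
          rw [h4, hV'card]
          omega)
        (fun s => (Finset.card_le_card (Finset.filter_subset_filter _
          Finset.sdiff_subset)).trans (hbd s))
      obtain ⟨X'', hX''⟩ := exists_cut_of_contract_set hV hy hZV hX'
      exact hno X'' t' hX''
    obtain ⟨y, rfl⟩ := Finset.card_eq_one.mp hZ1
    have hnin : ∀ f ∈ E, ¬ (∀ v ∈ ε f, v ∈ ({y} : Finset α)) := by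
      intro f hf hin
      have h0 : (inside ε E {y}).image c = ∅ := Finset.card_eq_zero.mp (by omega)
      simpa [h0] using Finset.mem_image_of_mem c (mem_inside.mpr ⟨hf, hin⟩)
    have hin : ∀ f ∈ E, y ∉ ε f → ∀ v ∈ ε f, v ∈ V \ {y} := fun f hf hyf v hv => by
      simp only [Finset.mem_sdiff, Finset.mem_singleton]
      exact ⟨hV f hf v hv, fun hvy => hyf (hvy ▸ hv)⟩
    refine ⟨g, hg, hge, hgc, y, hZV (by simp), t, fun h => hgt (hgc.trans h.symm), fun f hf => ?_⟩
    constructor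
    · intro hyf
      by_contra! hcon
      by_cases hfe : c f = c e
      · refine hcon.1 (hpair e he f hf g hg ?_ hge hfe hgc)
        rintro rfl
        simpa using (mem_inside.mp heI).2 y hyf
      · rcases hZ f hf hfe hcon.2 with h | h
        · exact hnin f hf h
        · simpa using h y hyf
    · rintro (rfl | hft)
      · by_contra hyf
        exact hgVZ (hin f hf hyf)
      · by_contra hyf
        exact ht2 (hft ▸ Finset.mem_image_of_mem c (mem_inside.mpr ⟨hf, hin f hf hyf⟩))
  have hle : E.card ≤ V.card := by
    refine card_edges_le_of_private_ends (c := c) (ε := ε) (fun e he => ?_) (fun h hh => ?_)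
    · obtain ⟨g, hg, hge, hgc, -⟩ := key e he
      exact ⟨g, hg, hge, hgc⟩
    · obtain ⟨g, hg, hgh, hgc, -⟩ := key h hh
      -- `key` describes a vertex at the partner of its argument, so it is applied to the partner
      -- `g` of `h`, whose own partner is `h` again.
      obtain ⟨g', hg', hgg', hgc', y, hy, t, ht, hf⟩ := key g hg
      obtain rfl : g' = h := hpair g hg g' hg' h hh hgg' (Ne.symm hgh) hgc' hgc.symm
      exact ⟨y, hy, t, fun h => ht (h.trans hgc'), hf⟩
  have hge : 2 * (E.image c).card ≤ E.card := by
    refine Finset.mul_card_image_le_card E 2 fun s hs => ?_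
    obtain ⟨e, he, rfl⟩ := Finset.mem_image.mp hs
    obtain ⟨g, hg, hge, hgc, -⟩ := key e he
    exact Finset.one_lt_card.mpr ⟨e, by simp [he], g, by simp [hg, hgc], hge.symm⟩
  omega

end RainbowLinkage

/-! ### Linkages, merges and clusters -/

namespace RainbowLinkage

variable {α β κ : Type*} [DecidableEq α] [DecidableEq β] [DecidableEq κ]

/-- `P` is a set of edges of `E` with pairwise distinct colours which connects `u` and `v`. -/
def RainbowConn (ε : β → Sym2 α) (c : β → κ) (E : Finset β) (u v : α) (P : Finset β) : Prop :=
  P ⊆ E ∧ Set.InjOn c P ∧ Conn ε P u v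

theorem RainbowConn.symm {ε : β → Sym2 α} {c : β → κ} {E P : Finset β} {u v : α}
    (h : RainbowConn ε c E u v P) : RainbowConn ε c E v u P :=
  ⟨h.1, h.2.1, h.2.2.symm⟩

theorem RainbowConn.mono {ε : β → Sym2 α} {c : β → κ} {E E' P : Finset β} {u v : α}
    (h : RainbowConn ε c E u v P) (hE : E ⊆ E') : RainbowConn ε c E' u v P :=
  ⟨h.1.trans hE, h.2⟩

theorem RainbowConn.refl {ε : β → Sym2 α} {c : β → κ} {E : Finset β} (u : α) :
    RainbowConn ε c E u u ∅ :=
  ⟨by simp, by simp, Conn.refl u⟩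

theorem RainbowConn.edge {ε : β → Sym2 α} {c : β → κ} {E : Finset β} {e : β} {u v : α}
    (he : e ∈ E) (h : ε e = s(u, v)) : RainbowConn ε c E u v {e} :=
  ⟨by simpa using he, by simp, Conn.edge (by simp) h⟩

/-- There are edge-disjoint rainbow connections from `u` to `x` and from `v` to `y`, with at most
`N` edges in total. -/
def Link (ε : β → Sym2 α) (c : β → κ) (E : Finset β) (u x v y : α) (N : ℕ) : Prop :=
  ∃ P Q, RainbowConn ε c E u x P ∧ RainbowConn ε c E v y Q ∧ Disjoint P Q ∧ P.card + Q.card ≤ N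

/-- The vertices of the pair `p` can be linked to those of `p'`, in one of the two possible ways,
by edge-disjoint rainbow connections with at most `N` edges in total. -/
def Linked (ε : β → Sym2 α) (c : β → κ) (E : Finset β) (p p' : Sym2 α) (N : ℕ) : Prop :=
  ∃ u v x y, p = s(u, v) ∧ p' = s(x, y) ∧ Link ε c E u x v y N

theorem Linked.symm {ε : β → Sym2 α} {c : β → κ} {E : Finset β} {p p' : Sym2 α} {N : ℕ}
    (h : Linked ε c E p p' N) : Linked ε c E p' p N := by
  obtain ⟨u, v, x, y, h1, h2, P, Q, hP, hQ, h3⟩ := h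
  exact ⟨x, y, u, v, h2, h1, P, Q, hP.symm, hQ.symm, h3⟩

theorem Linked.mono {ε : β → Sym2 α} {c : β → κ} {E E' : Finset β} {p p' : Sym2 α} {N N' : ℕ}
    (h : Linked ε c E p p' N) (hE : E ⊆ E') (hN : N ≤ N') : Linked ε c E' p p' N' := by
  obtain ⟨u, v, x, y, h1, h2, P, Q, hP, hQ, h3, h4⟩ := h
  exact ⟨u, v, x, y, h1, h2, P, Q, hP.mono hE, hQ.mono hE, h3, h4.trans hN⟩

theorem Linked.exists_link {ε : β → Sym2 α} {c : β → κ} {E : Finset β} {p : Sym2 α} {x y : α}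
    {N : ℕ} (h : Linked ε c E p s(x, y) N) : ∃ u v, p = s(u, v) ∧ Link ε c E u x v y N := by
  obtain ⟨u, v, x', y', h1, h2, P, Q, hP, hQ, h3, h4⟩ := h
  rcases Sym2.eq_iff.mp h2 with ⟨rfl, rfl⟩ | ⟨rfl, rfl⟩
  · exact ⟨u, v, h1, P, Q, hP, hQ, h3, h4⟩
  · exact ⟨v, u, h1.trans Sym2.eq_swap, Q, P, hQ, hP, h3.symm, by omega⟩

/-- A vertex set with a set of edges, a set of distinguished (colour-singular) edges and a number
which counts them. -/
structure Piece (α β : Type*) where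
  verts : Finset α
  edges : Finset β
  singular : Finset β
  rank : ℕ

/-- `C` arises from the disjoint pieces `A` and `B` by adding the edges `e` and `f`, which have the
same new colour. If `e = f`, this edge is colour-singular. -/
structure IsMerge (ε : β → Sym2 α) (c : β → κ) (A B C : Piece α β) (e f : β) (a b a' b' : α) :
    Prop where
  verts_eq : C.verts = A.verts ∪ B.verts
  edges_eq : C.edges = insert e (insert f (A.edges ∪ B.edges))
  disj : Disjoint A.verts B.verts
  ends : ε e = s(a, b)
  ends' : ε f = s(a', b')
  left_mem : a ∈ A.verts
  right_mem : b ∈ B.verts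
  left_mem' : a' ∈ A.verts
  right_mem' : b' ∈ B.verts
  colour_eq : c e = c f
  colour_left : ∀ g ∈ A.edges, c g ≠ c e
  colour_right : ∀ g ∈ B.edges, c g ≠ c e
  colour_ne : ∀ g ∈ A.edges, ∀ h ∈ B.edges, c g ≠ c h
  single_or_double :
    (e = f ∧ a = a' ∧ b = b' ∧ C.singular = insert e (A.singular ∪ B.singular) ∧
      C.rank = A.rank + B.rank + 1) ∨
    (e ≠ f ∧ (a ≠ a' ∨ b ≠ b') ∧ C.singular = A.singular ∪ B.singular ∧
      C.rank = A.rank + B.rank)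

/-- The pieces which arise from single vertices by merging. -/
inductive Cluster (ε : β → Sym2 α) (c : β → κ) : Piece α β → Prop
  | leaf (v : α) : Cluster ε c ⟨{v}, ∅, ∅, 0⟩
  | merge {A B C : Piece α β} {e f : β} {a b a' b' : α} : Cluster ε c A → Cluster ε c B →
      IsMerge ε c A B C e f a b a' b' → Cluster ε c C

namespace IsMerge

variable {ε : β → Sym2 α} {c : β → κ} {A B C : Piece α β} {e f : β} {a b a' b' : α}

theorem swap (h : IsMerge ε c A B C e f a b a' b') : IsMerge ε c A B C f e a' b' a b where
  verts_eq := h.verts_eq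
  edges_eq := by rw [h.edges_eq, Finset.insert_comm]
  disj := h.disj
  ends := h.ends'
  ends' := h.ends
  left_mem := h.left_mem'
  right_mem := h.right_mem'
  left_mem' := h.left_mem
  right_mem' := h.right_mem
  colour_eq := h.colour_eq.symm
  colour_left := h.colour_eq ▸ h.colour_left
  colour_right := h.colour_eq ▸ h.colour_right
  colour_ne := h.colour_ne
  single_or_double := by
    rcases h.single_or_double with ⟨h1, h2, h3, h4, h5⟩ | ⟨h1, h2, h3, h4⟩
    · exact Or.inl ⟨h1.symm, h2.symm, h3.symm, h1 ▸ h4, h5⟩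
    · exact Or.inr ⟨h1.symm, h2.imp Ne.symm Ne.symm, h3, h4⟩

theorem symm (h : IsMerge ε c A B C e f a b a' b') : IsMerge ε c B A C e f b a b' a' where
  verts_eq := by rw [h.verts_eq, Finset.union_comm]
  edges_eq := by rw [h.edges_eq, Finset.union_comm A.edges]
  disj := h.disj.symm
  ends := h.ends.trans Sym2.eq_swap
  ends' := h.ends'.trans Sym2.eq_swap
  left_mem := h.right_mem
  right_mem := h.left_mem
  left_mem' := h.right_mem'
  right_mem' := h.left_mem'
  colour_eq := h.colour_eq
  colour_left := h.colour_right
  colour_right := h.colour_left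
  colour_ne := fun g hg k hk => (h.colour_ne k hk g hg).symm
  single_or_double := by
    rcases h.single_or_double with ⟨h1, h2, h3, h4, h5⟩ | ⟨h1, h2, h3, h4⟩
    · exact Or.inl ⟨h1, h3, h2, by rw [h4, Finset.union_comm], by omega⟩
    · exact Or.inr ⟨h1, h2.symm, by rw [h3, Finset.union_comm], by omega⟩

theorem card_verts (h : IsMerge ε c A B C e f a b a' b') :
    C.verts.card = A.verts.card + B.verts.card := by
  rw [h.verts_eq, Finset.card_union_of_disjoint h.disj]

theorem left_verts (h : IsMerge ε c A B C e f a b a' b') : A.verts ⊆ C.verts := by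
  rw [h.verts_eq]; exact Finset.subset_union_left

theorem left_edges (h : IsMerge ε c A B C e f a b a' b') : A.edges ⊆ C.edges := by
  rw [h.edges_eq]; intro g hg; simp [hg]

theorem edge_mem (h : IsMerge ε c A B C e f a b a' b') : e ∈ C.edges := by
  rw [h.edges_eq]; simp

theorem left_singular (h : IsMerge ε c A B C e f a b a' b') : A.singular ⊆ C.singular := by
  intro g hg
  rcases h.single_or_double with ⟨-, -, -, h4, -⟩ | ⟨-, -, h4, -⟩ <;> rw [h4] <;> simp [hg]

theorem notMem_left (h : IsMerge ε c A B C e f a b a' b') : e ∉ A.edges := fun he =>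
  h.colour_left e he rfl

theorem disjoint_edges (h : IsMerge ε c A B C e f a b a' b') : Disjoint A.edges B.edges :=
  Finset.disjoint_left.mpr fun g hg hg' => h.colour_ne g hg g hg' rfl

/-- A rainbow connection inside `A`, the edge `e` and a rainbow connection inside `B` form a rainbow
connection. -/
theorem rainbowConn (h : IsMerge ε c A B C e f a b a' b') {u v : α} {P Q : Finset β}
    (hP : RainbowConn ε c A.edges u a P) (hQ : RainbowConn ε c B.edges b v Q) :
    RainbowConn ε c C.edges u v (P ∪ insert e Q) := by
  refine ⟨?_, ?_, ?_⟩
  · refine Finset.union_subset (hP.1.trans h.left_edges) (Finset.insert_subset h.edge_mem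
      (hQ.1.trans h.symm.left_edges))
  · intro x hx y hy hxy
    simp only [Finset.coe_union, Finset.coe_insert, Set.mem_union, Set.mem_insert_iff,
      Finset.mem_coe] at hx hy
    rcases hx with hx | rfl | hx <;> rcases hy with hy | rfl | hy
    · exact hP.2.1 hx hy hxy
    · exact absurd hxy (h.colour_left x (hP.1 hx))
    · exact absurd hxy (h.colour_ne x (hP.1 hx) y (hQ.1 hy))
    · exact absurd hxy.symm (h.colour_left y (hP.1 hy))
    · rfl
    · exact absurd hxy.symm (h.colour_right y (hQ.1 hy))
    · exact absurd hxy.symm (h.colour_ne y (hP.1 hy) x (hQ.1 hx))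
    · exact absurd hxy (h.colour_right x (hQ.1 hx))
    · exact hQ.2.1 hx hy hxy
  · refine ((hP.2.2.mono Finset.subset_union_left).trans (Conn.edge ?_ h.ends)).trans
      (hQ.2.2.mono ?_)
    · simp
    · exact (Finset.subset_insert _ _).trans Finset.subset_union_right

end IsMerge

namespace Cluster

variable {ε : β → Sym2 α} {c : β → κ} {A B C : Piece α β} {e f : β} {a b a' b' : α}

theorem nonempty (h : Cluster ε c C) : C.verts.Nonempty := by
  induction h with
  | leaf v => simp
  | merge hA hB hm ihA ihB => exact ihA.mono hm.left_verts

theorem card_pos (h : Cluster ε c C) : 1 ≤ C.verts.card :=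
  Finset.card_pos.mpr h.nonempty

/-- Without single-edge merges the first merge would join two single vertices by two distinct
non-parallel edges, which is impossible. Through `rank_pos`, distinct attachment vertices on a side
therefore cost that side rank. -/
theorem eq_of_rank_eq_zero (h : Cluster ε c C) (h0 : C.rank = 0) {u v : α} (hu : u ∈ C.verts)
    (hv : v ∈ C.verts) : u = v := by
  induction h generalizing u v with
  | leaf w => simp only [Finset.mem_singleton] at hu hv; rw [hu, hv]
  | merge hA hB hm ihA ihB =>
    rcases hm.single_or_double with ⟨-, -, -, -, h5⟩ | ⟨-, h2 | h2, -, h5⟩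
    · omega
    · exact absurd (ihA (by omega) hm.left_mem hm.left_mem') h2
    · exact absurd (ihB (by omega) hm.right_mem hm.right_mem') h2

theorem rank_pos (h : Cluster ε c C) {u v : α} (hu : u ∈ C.verts) (hv : v ∈ C.verts)
    (hne : u ≠ v) : 1 ≤ C.rank := by
  by_contra h0
  exact hne (h.eq_of_rank_eq_zero (by omega) hu hv)

theorem card_singular_le (h : Cluster ε c C) : C.singular.card ≤ C.rank := by
  induction h with
  | leaf v => simp
  | @merge A B C e f a b a' b' hA hB hm ihA ihB =>
    have h1 := Finset.card_union_le A.singular B.singular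
    rcases hm.single_or_double with ⟨-, -, -, h4, h5⟩ | ⟨-, -, h4, h5⟩
    · have h2 := Finset.card_insert_le e (A.singular ∪ B.singular)
      rw [h4]; omega
    · rw [h4]; omega

theorem singular_subset (h : Cluster ε c C) : C.singular ⊆ C.edges := by
  induction h with
  | leaf v => simp
  | merge hA hB hm ihA ihB =>
    have h1 := Finset.union_subset (ihA.trans hm.left_edges) (ihB.trans hm.symm.left_edges)
    rcases hm.single_or_double with ⟨-, -, -, h4, -⟩ | ⟨-, -, h4, -⟩
    · rw [h4]; exact Finset.insert_subset hm.edge_mem h1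
    · rw [h4]; exact h1

theorem eq_of_mem_singular (h : Cluster ε c C) {e f : β} (he : e ∈ C.singular) (hf : f ∈ C.edges)
    (hc : c f = c e) : f = e := by
  induction h with
  | leaf v => simp at he
  | @merge A B C g g' a b a' b' hA hB hm ihA ihB =>
    rw [hm.edges_eq] at hf
    simp only [Finset.mem_insert, Finset.mem_union] at hf
    have hAB : e ∈ A.singular ∪ B.singular → f = e := by
      intro he
      rcases Finset.mem_union.mp he with he | he
      · have he' := hA.singular_subset he
        rcases hf with rfl | rfl | hf | hf
        · exact absurd hc.symm (hm.colour_left e he')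
        · exact absurd hc.symm (hm.swap.colour_left e he')
        · exact ihA he hf
        · exact absurd hc.symm (hm.colour_ne e he' f hf)
      · have he' := hB.singular_subset he
        rcases hf with rfl | rfl | hf | hf
        · exact absurd hc.symm (hm.colour_right e he')
        · exact absurd hc.symm (hm.swap.colour_right e he')
        · exact absurd hc (hm.colour_ne f hf e he')
        · exact ihB he hf
    rcases hm.single_or_double with ⟨h1, -, -, h4, -⟩ | ⟨-, -, h4, -⟩
    · rw [h4] at he
      rcases Finset.mem_insert.mp he with rfl | he
      · rcases hf with rfl | rfl | hf | hf
        · rfl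
        · exact h1.symm
        · exact absurd hc (hm.colour_left f hf)
        · exact absurd hc (hm.colour_right f hf)
      · exact hAB he
    · rw [h4] at he
      exact hAB he

/-- A single merge adds one edge and one unit of rank, a double merge two edges and no rank. This
identifies the rank with `k`. -/
theorem card_edges (h : Cluster ε c C) : C.edges.card + C.rank + 2 = 2 * C.verts.card := by
  induction h with
  | leaf v => simp
  | @merge A B C e f a b a' b' hA hB hm ihA ihB =>
    have h1 : e ∉ A.edges ∪ B.edges := by simp [hm.notMem_left, hm.symm.notMem_left]
    have h2 : f ∉ A.edges ∪ B.edges := by simp [hm.swap.notMem_left, hm.swap.symm.notMem_left]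
    have h3 := Finset.card_union_of_disjoint hm.disjoint_edges
    rw [hm.card_verts, hm.edges_eq]
    rcases hm.single_or_double with ⟨rfl, -, -, -, h5⟩ | ⟨hne, -, -, h5⟩
    · rw [Finset.insert_idem, Finset.card_insert_of_notMem h1]
      omega
    · rw [Finset.card_insert_of_notMem (by simpa [hne] using h1), Finset.card_insert_of_notMem h2]
      omega

theorem exists_rainbowConn (h : Cluster ε c C) {u v : α} (hu : u ∈ C.verts) (hv : v ∈ C.verts) :
    ∃ P, RainbowConn ε c C.edges u v P ∧ P.card + 1 ≤ C.verts.card := by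
  induction h generalizing u v with
  | leaf w =>
    simp only [Finset.mem_singleton] at hu hv
    rw [hu, hv]
    exact ⟨∅, RainbowConn.refl w, by simp⟩
  | @merge A B C e f a b a' b' hA hB hm ihA ihB =>
    have hcard := hm.card_verts
    rw [hm.verts_eq, Finset.mem_union] at hu hv
    have cross : ∀ {u v}, u ∈ A.verts → v ∈ B.verts →
        ∃ P, RainbowConn ε c C.edges u v P ∧ P.card + 1 ≤ C.verts.card := by
      intro u v hu hv
      obtain ⟨P, hP, hP'⟩ := ihA hu hm.left_mem
      obtain ⟨Q, hQ, hQ'⟩ := ihB hm.right_mem hv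
      refine ⟨_, hm.rainbowConn hP hQ, ?_⟩
      have h1 := Finset.card_union_le P (insert e Q)
      have h2 := Finset.card_insert_le e Q
      omega
    rcases hu with hu | hu <;> rcases hv with hv | hv
    · obtain ⟨P, hP, hP'⟩ := ihA hu hv
      exact ⟨P, hP.mono hm.left_edges, by omega⟩
    · exact cross hu hv
    · obtain ⟨P, hP, hP'⟩ := cross hv hu
      exact ⟨P, hP.symm, hP'⟩
    · obtain ⟨P, hP, hP'⟩ := ihB hu hv
      exact ⟨P, hP.mono hm.symm.left_edges, by omega⟩

/-- The common vertex `w` is linked to itself for free. -/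
theorem linked_of_common (h : Cluster ε c C) {w u x : α} (hu : u ∈ C.verts) (hx : x ∈ C.verts)
    {N : ℕ} (hN : C.verts.card ≤ N + 1) : Linked ε c C.edges s(w, u) s(w, x) N := by
  obtain ⟨P, hP, hP'⟩ := h.exists_rainbowConn hu hx
  exact ⟨w, u, w, x, rfl, rfl, ∅, P, RainbowConn.refl w, hP, by simp, by simp; omega⟩

end Cluster

namespace IsMerge

variable {ε : β → Sym2 α} {c : β → κ} {A B C : Piece α β} {e f : β} {a b a' b' : α}

/-- The connection reaching `a` continues over `e` and through `B`, at a cost of at most `|B|`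
edges; the other one stays in `A`, so disjointness persists. -/
theorem linked_extend (h : IsMerge ε c A B C e f a b a' b') (hB : Cluster ε c B) {p : Sym2 α}
    {z y : α} {M N : ℕ} (hp : Linked ε c A.edges p s(a, z) M) (hy : y ∈ B.verts)
    (hN : M + B.verts.card ≤ N) : Linked ε c C.edges p s(y, z) N := by
  obtain ⟨u, v, rfl, P, Q, hP, hQ, hPQ, hM⟩ := hp.exists_link
  obtain ⟨R, hR, hR'⟩ := hB.exists_rainbowConn h.right_mem hy
  refine ⟨u, v, y, z, rfl, rfl, P ∪ insert e R, Q, h.rainbowConn hP hR, hQ.mono h.left_edges,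
    ?_, ?_⟩
  · rw [Finset.disjoint_union_left, Finset.disjoint_insert_left]
    exact ⟨hPQ, fun he => h.notMem_left (hQ.1 he),
      (Finset.disjoint_of_subset_left hQ.1 (Finset.disjoint_of_subset_right hR.1
        h.disjoint_edges)).symm⟩
  · have h1 := Finset.card_union_le P (insert e R)
    have h2 := Finset.card_insert_le e R
    omega

theorem linked_parallel (h : IsMerge ε c A B C e f a b a' b') (hA : Cluster ε c A)
    (hB : Cluster ε c B) {u x v y : α} (hu : u ∈ A.verts) (hx : x ∈ A.verts) (hv : v ∈ B.verts)
    (hy : y ∈ B.verts) {N : ℕ} (hN : C.verts.card ≤ N + 2) :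
    Linked ε c C.edges s(u, v) s(x, y) N := by
  obtain ⟨P, hP, hP'⟩ := hA.exists_rainbowConn hu hx
  obtain ⟨Q, hQ, hQ'⟩ := hB.exists_rainbowConn hv hy
  refine ⟨u, v, x, y, rfl, rfl, P, Q, hP.mono h.left_edges, hQ.mono h.symm.left_edges,
    Finset.disjoint_of_subset_left hP.1 (Finset.disjoint_of_subset_right hQ.1 h.disjoint_edges),
    ?_⟩
  have := h.card_verts
  omega

/-- The two crossing edges share a colour but are used by different connections, so each connection
stays rainbow. -/
theorem linked_cross (h : IsMerge ε c A B C e f a b a' b') (hef : e ≠ f) {p p' : Sym2 α}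
    {M M' N : ℕ} (hp : Linked ε c A.edges p s(a, a') M) (hp' : Linked ε c B.edges p' s(b, b') M')
    (hN : M + M' + 2 ≤ N) : Linked ε c C.edges p p' N := by
  obtain ⟨u, v, rfl, P, Q, hP, hQ, hPQ, hM⟩ := hp.exists_link
  obtain ⟨x, y, rfl, R, T, hR, hT, hRT, hM'⟩ := hp'.exists_link
  refine ⟨u, v, x, y, rfl, rfl, _, _, h.rainbowConn hP hR.symm, h.swap.rainbowConn hQ hT.symm,
    ?_, ?_⟩
  · have hAB := Finset.disjoint_left.mp h.disjoint_edges
    have h1 := h.notMem_left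
    have h2 := h.symm.notMem_left
    have h3 := h.swap.notMem_left
    have h4 := h.swap.symm.notMem_left
    rw [Finset.disjoint_left] at hPQ hRT ⊢
    intro g hg hg'
    simp only [Finset.mem_union, Finset.mem_insert] at hg hg'
    rcases hg with hg | rfl | hg <;> rcases hg' with hg' | rfl | hg'
    · exact hPQ hg hg'
    · exact h3 (hP.1 hg)
    · exact hAB (hP.1 hg) (hT.1 hg')
    · exact h1 (hQ.1 hg')
    · exact hef rfl
    · exact h2 (hT.1 hg')
    · exact hAB (hQ.1 hg') (hR.1 hg)
    · exact h4 (hR.1 hg)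
    · exact hRT hg hg'
  · have h1 := Finset.card_union_le P (insert e R)
    have h2 := Finset.card_insert_le e R
    have h3 := Finset.card_union_le Q (insert f T)
    have h4 := Finset.card_insert_le f T
    omega

theorem pair_cases (h : IsMerge ε c A B C e f a b a' b') {p : Sym2 α} (hp : ∀ v ∈ p, v ∈ C.verts) :
    (∀ v ∈ p, v ∈ A.verts) ∨ (∀ v ∈ p, v ∈ B.verts) ∨
      ∃ x ∈ A.verts, ∃ y ∈ B.verts, p = s(x, y) := by
  induction p with
  | h x y =>
    rw [h.verts_eq] at hp
    have hx := hp x (by simp)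
    have hy := hp y (by simp)
    rw [Finset.mem_union] at hx hy
    simp only [Sym2.mem_iff, forall_eq_or_imp, forall_eq]
    rcases hx with hx | hx <;> rcases hy with hy | hy
    · exact Or.inl ⟨hx, hy⟩
    · exact Or.inr (Or.inr ⟨x, hx, y, hy, rfl⟩)
    · exact Or.inr (Or.inr ⟨y, hy, x, hx, Sym2.eq_swap⟩)
    · exact Or.inr (Or.inl ⟨hx, hy⟩)

end IsMerge

end RainbowLinkage

/-! ### Linking pairs in clusters of rank at most three -/

namespace RainbowLinkage

variable {α β κ : Type*} [DecidableEq α] [DecidableEq β] [DecidableEq κ]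

/-- `1` if the two members of the pair coincide, and `0` otherwise. -/
def diagonal (p : Sym2 α) : ℕ := if p.IsDiag then 1 else 0

@[simp]
theorem diagonal_self (u : α) : diagonal s(u, u) = 1 := by simp [diagonal]

theorem diagonal_of_ne {u v : α} (h : u ≠ v) : diagonal s(u, v) = 0 := by simp [diagonal, h]

theorem pair_eq_self {p : Sym2 α} {b : α} (h : ∀ v ∈ p, v = b) : p = s(b, b) := by
  induction p with
  | h x y => rw [h x (by simp), h y (by simp)]

theorem exists_mem_pair (p : Sym2 α) : ∃ v, v ∈ p := by
  induction p with
  | h x y => exact ⟨x, by simp⟩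

variable {ε : β → Sym2 α} {c : β → κ} {A B C : Piece α β} {e f : β} {a b a' b' : α}

theorem Cluster.card_eq_one (h : Cluster ε c B) (h0 : B.rank = 0) : B.verts.card = 1 := by
  have h1 := h.card_pos
  have h2 : B.verts.card ≤ 1 :=
    Finset.card_le_one.mpr fun u hu v hv => h.eq_of_rank_eq_zero h0 hu hv
  omega

/-! ### At most one singular edge -/

/-- Any two pairs of `C` which are not both degenerate can be linked by few edges; for degenerate
pairs this fails only if they are joined by a singular edge. -/
def LinkOne (ε : β → Sym2 α) (c : β → κ) (C : Piece α β) : Prop :=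
  ∀ p q : Sym2 α, (∀ v ∈ p, v ∈ C.verts) → (∀ v ∈ q, v ∈ C.verts) →
    Linked ε c C.edges p q (C.verts.card + diagonal p + diagonal q - 2) ∨
      ∃ u x, p = s(u, u) ∧ q = s(x, x) ∧ ∃ g ∈ C.singular, ε g = s(u, x)

theorem IsMerge.linkOne_single (h : IsMerge ε c A B C e f a b a' b') (hA : Cluster ε c A)
    (hB : Cluster ε c B) (hef : e = f) (hA0 : A.rank = 0) (hB0 : B.rank = 0) :
    LinkOne ε c C := by
  intro p q hp hq
  have hC := Cluster.merge hA hB h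
  have hcard := h.card_verts
  rw [hA.card_eq_one hA0, hB.card_eq_one hB0] at hcard
  have heA : ∀ v ∈ A.verts, v = a := fun v hv => hA.eq_of_rank_eq_zero hA0 hv h.left_mem
  have heB : ∀ v ∈ B.verts, v = b := fun v hv => hB.eq_of_rank_eq_zero hB0 hv h.right_mem
  have ha := h.left_verts h.left_mem
  have hb := h.symm.left_verts h.right_mem
  have hab : a ≠ b := fun hab => Finset.disjoint_left.mp h.disj h.left_mem (hab ▸ h.right_mem)
  have he : e ∈ C.singular := by
    rcases h.single_or_double with ⟨-, -, -, h4, -⟩ | ⟨h1, -⟩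
    · rw [h4]; simp
    · exact absurd hef h1
  have key : ∀ r : Sym2 α, (∀ v ∈ r, v ∈ C.verts) → r = s(a, a) ∨ r = s(b, b) ∨ r = s(a, b) := by
    intro r hr
    rcases h.pair_cases hr with hr | hr | ⟨x, hx, y, hy, rfl⟩
    · exact Or.inl (pair_eq_self fun v hv => heA v (hr v hv))
    · exact Or.inr (Or.inl (pair_eq_self fun v hv => heB v (hr v hv)))
    · rw [heA x hx, heB y hy]; simp
  have hd := diagonal_of_ne hab
  rcases key p hp with rfl | rfl | rfl <;> rcases key q hq with rfl | rfl | rfl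
  · exact Or.inl (hC.linked_of_common ha ha (by simp only [diagonal_self]; omega))
  · exact Or.inr ⟨a, b, rfl, rfl, e, he, h.ends⟩
  · exact Or.inl (hC.linked_of_common ha hb (by simp only [diagonal_self]; omega))
  · exact Or.inr ⟨b, a, rfl, rfl, e, he, h.symm.ends⟩
  · exact Or.inl (hC.linked_of_common hb hb (by simp only [diagonal_self]; omega))
  · rw [Sym2.eq_swap (a := a)] at hd ⊢
    exact Or.inl (hC.linked_of_common hb ha (by simp only [diagonal_self]; omega))
  · exact Or.inl (hC.linked_of_common hb ha (by simp only [diagonal_self]; omega))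
  · rw [Sym2.eq_swap (a := a)] at hd ⊢
    exact Or.inl (hC.linked_of_common ha hb (by simp only [diagonal_self]; omega))
  · exact Or.inl (h.linked_parallel hA hB h.left_mem h.left_mem h.right_mem h.right_mem
      (by omega))

/-- `B` is one vertex, joined to distinct `a`, `a'`. Its degenerate pair is traded for `s(a, a')` in
`A`, and a split pair at `x` for `s(u, x)` with an attachment vertex `u ≠ x`. These pairs are not
degenerate, hence never exceptional. -/
theorem IsMerge.linkOne_double (h : IsMerge ε c A B C e f a b a' b') (hA : Cluster ε c A)
    (hB : Cluster ε c B) (hef : e ≠ f) (hB0 : B.rank = 0) (ih : LinkOne ε c A) :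
    LinkOne ε c C := by
  have hC := Cluster.merge hA hB h
  have hcard := h.card_verts
  have hApos := hA.card_pos
  have hB1 := hB.card_eq_one hB0
  have heB : ∀ v ∈ B.verts, v = b := fun v hv => hB.eq_of_rank_eq_zero hB0 hv h.right_mem
  obtain rfl := heB b' h.right_mem'
  have haa : a ≠ a' := by
    rcases h.single_or_double with ⟨h1, -⟩ | ⟨-, h2 | h2, -⟩
    · exact absurd h1 hef
    · exact h2
    · exact absurd rfl h2
  have hdaa := diagonal_of_ne haa
  have hb := h.symm.left_verts h.right_mem
  have self : ∀ q : Sym2 α, (∀ v ∈ q, v ∈ A.verts) → Linked ε c C.edges s(b', b') q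
      (C.verts.card + diagonal s(b', b') + diagonal q - 2) := by
    intro q hq
    rcases ih q s(a, a') hq (by
      simp only [Sym2.mem_iff, forall_eq_or_imp, forall_eq]
      exact ⟨h.left_mem, h.left_mem'⟩) with h1 | ⟨u, x, -, h2, -⟩
    · refine (h.linked_cross hef h1 (hB.linked_of_common (N := 0) h.right_mem h.right_mem
        (by omega)) ?_).symm
      simp only [diagonal_self]
      -- This keeps the truncated subtraction of `2` exact.
      have : 1 ≤ diagonal q ∨ 2 ≤ A.verts.card := Or.inr (Finset.one_lt_card.mpr
        ⟨a, h.left_mem, a', h.left_mem', haa⟩)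
      omega
    · rcases Sym2.eq_iff.mp h2 with ⟨rfl, rfl⟩ | ⟨rfl, rfl⟩ <;> exact absurd rfl haa
  have split : ∀ x ∈ A.verts, ∀ q : Sym2 α, (∀ v ∈ q, v ∈ A.verts) →
      Linked ε c C.edges s(x, b') q (C.verts.card + diagonal s(x, b') + diagonal q - 2) := by
    have aux : ∀ {g g' : β} {u u' : α}, IsMerge ε c A B C g g' u b' u' b' → ∀ x ∈ A.verts, u ≠ x →
        ∀ q : Sym2 α, (∀ v ∈ q, v ∈ A.verts) →
        Linked ε c C.edges s(x, b') q (C.verts.card + diagonal s(x, b') + diagonal q - 2) := by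
      intro g g' u u' h x hx hux q hq
      rcases ih q s(u, x) hq (by
        simp only [Sym2.mem_iff, forall_eq_or_imp, forall_eq]
        exact ⟨h.left_mem, hx⟩) with h1 | ⟨u, x, -, h2, -⟩
      · rw [Sym2.eq_swap (a := x)]
        refine (h.linked_extend hB h1 h.right_mem ?_).symm
        have : 2 ≤ A.verts.card := Finset.one_lt_card.mpr ⟨u, h.left_mem, x, hx, hux⟩
        rw [diagonal_of_ne hux]
        omega
      · rcases Sym2.eq_iff.mp h2 with ⟨rfl, rfl⟩ | ⟨rfl, rfl⟩ <;> exact absurd rfl hux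
    intro x hx
    by_cases hax : a = x
    · exact aux h.swap x hx (fun h => haa (hax.trans h.symm))
    · exact aux h x hx hax
  have hne : ∀ x ∈ A.verts, x ≠ b' := fun x hx hxb =>
    Finset.disjoint_left.mp h.disj hx (hxb ▸ h.right_mem)
  intro p q hp hq
  rcases h.pair_cases hp with hp | hp | ⟨x, hx, y, hy, rfl⟩ <;>
    rcases h.pair_cases hq with hq | hq | ⟨x', hx', y', hy', rfl⟩
  · rcases ih p q hp hq with h1 | ⟨u, x, h1, h2, g, hg, h3⟩
    · exact Or.inl (h1.mono h.left_edges (by omega))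
    · exact Or.inr ⟨u, x, h1, h2, g, h.left_singular hg, h3⟩
  · obtain rfl := pair_eq_self fun v hv => heB v (hq v hv)
    exact Or.inl ((self p hp).symm.mono subset_rfl (by omega))
  · obtain rfl := heB y' hy'
    exact Or.inl ((split x' hx' p hp).symm.mono subset_rfl (by omega))
  · obtain rfl := pair_eq_self fun v hv => heB v (hp v hv)
    exact Or.inl (self q hq)
  · obtain rfl := pair_eq_self fun v hv => heB v (hp v hv)
    obtain rfl := pair_eq_self fun v hv => heB v (hq v hv)
    exact Or.inl (hC.linked_of_common hb hb (by simp only [diagonal_self]; omega))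
  · obtain rfl := pair_eq_self fun v hv => heB v (hp v hv)
    obtain rfl := heB y' hy'
    rw [Sym2.eq_swap (a := x')]
    exact Or.inl (hC.linked_of_common hb (h.left_verts hx') (by simp only [diagonal_self]; omega))
  · obtain rfl := heB y hy
    exact Or.inl (split x hx q hq)
  · obtain rfl := pair_eq_self fun v hv => heB v (hq v hv)
    obtain rfl := heB y hy
    rw [Sym2.eq_swap (a := x)]
    exact Or.inl (hC.linked_of_common (h.left_verts hx) hb (by simp only [diagonal_self]; omega))
  · exact Or.inl (h.linked_parallel hA hB hx hx' hy hy' (by omega))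

theorem Cluster.linkOne (h : Cluster ε c C) (hr : C.rank ≤ 1) : LinkOne ε c C := by
  induction h with
  | leaf v =>
    intro p q hp hq
    obtain rfl := pair_eq_self fun w hw => Finset.mem_singleton.mp (hp w hw)
    obtain rfl := pair_eq_self fun w hw => Finset.mem_singleton.mp (hq w hw)
    exact Or.inl ((Cluster.leaf v).linked_of_common (by simp) (by simp) (by simp))
  | @merge A B C e f a b a' b' hA hB hm ihA ihB =>
    rcases hm.single_or_double with ⟨h1, -, -, -, h5⟩ | ⟨h1, h2, -, h5⟩
    · exact hm.linkOne_single hA hB h1 (by omega) (by omega)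
    · rcases h2 with h2 | h2
      · have := hA.rank_pos hm.left_mem hm.left_mem' h2
        exact hm.linkOne_double hA hB h1 (by omega) (ihA (by omega))
      · have := hB.rank_pos hm.right_mem hm.right_mem' h2
        exact hm.symm.linkOne_double hB hA h1 (by omega) (ihB (by omega))

theorem Cluster.linked_of_ne (h : Cluster ε c C) (hr : C.rank ≤ 1) {p : Sym2 α} {x y : α}
    (hp : ∀ v ∈ p, v ∈ C.verts) (hx : x ∈ C.verts) (hy : y ∈ C.verts) (hxy : x ≠ y) :
    Linked ε c C.edges p s(x, y) (C.verts.card + diagonal p - 2) := by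
  rcases h.linkOne hr p s(x, y) hp (by
    simp only [Sym2.mem_iff, forall_eq_or_imp, forall_eq]
    exact ⟨hx, hy⟩) with h1 | ⟨u, z, -, h2, -⟩
  · rwa [diagonal_of_ne hxy] at h1
  · rcases Sym2.eq_iff.mp h2 with ⟨rfl, rfl⟩ | ⟨rfl, rfl⟩ <;> exact absurd rfl hxy

end RainbowLinkage

namespace RainbowLinkage

variable {α β κ : Type*} [DecidableEq α] [DecidableEq β] [DecidableEq κ]
variable {ε : β → Sym2 α} {c : β → κ} {A B C : Piece α β} {e f : β} {a b a' b' : α}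

/-! ### At most two singular edges -/

/-- One of the pairs `p`, `q` can be linked by few edges to the vertex `o` and some vertex of the
other pair. -/
def Detour (ε : β → Sym2 α) (c : β → κ) (E : Finset β) (n : ℕ) (o : α) (p q : Sym2 α) : Prop :=
  (∃ z ∈ q, Linked ε c E p s(o, z) (n + diagonal p - 1)) ∨
    (∃ y ∈ p, Linked ε c E q s(o, y) (n + diagonal q - 1))

theorem Detour.symm {E : Finset β} {n : ℕ} {o : α} {p q : Sym2 α} (h : Detour ε c E n o p q) :
    Detour ε c E n o q p :=
  Or.symm h

/-- The pairs are degenerate, and `o` is joined to both of them by edges of `S`. -/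
def TwoStar (ε : β → Sym2 α) (S : Finset β) (o : α) (p q : Sym2 α) : Prop :=
  ∃ y z, p = s(y, y) ∧ q = s(z, z) ∧ y ≠ z ∧ ∃ g ∈ S, ∃ g' ∈ S, ε g = s(o, y) ∧ ε g' = s(o, z)

theorem TwoStar.symm {S : Finset β} {o : α} {p q : Sym2 α} (h : TwoStar ε S o p q) :
    TwoStar ε S o q p := by
  obtain ⟨y, z, hp, hq, hne, g, hg, g', hg', h1, h2⟩ := h
  exact ⟨z, y, hq, hp, hne.symm, g', hg', g, hg, h2, h1⟩

theorem TwoStar.mono {S S' : Finset β} {o : α} {p q : Sym2 α} (h : TwoStar ε S o p q)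
    (hS : S ⊆ S') : TwoStar ε S' o p q := by
  obtain ⟨y, z, hp, hq, hne, g, hg, g', hg', h⟩ := h
  exact ⟨y, z, hp, hq, hne, g, hS hg, g', hS hg', h⟩

theorem TwoStar.edges_ne {g g' : β} {o y z : α} (hne : y ≠ z) (h : ε g = s(o, y))
    (h' : ε g' = s(o, z)) : g ≠ g' := by
  rintro rfl
  rw [h] at h'
  rcases Sym2.eq_iff.mp h' with ⟨-, h2⟩ | ⟨h1, h2⟩
  · exact hne h2
  · exact hne (h2.trans h1)

theorem TwoStar.two_le {S : Finset β} {o : α} {p q : Sym2 α} (h : TwoStar ε S o p q) :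
    2 ≤ S.card := by
  obtain ⟨y, z, hp, hq, hne, g, hg, g', hg', h1, h2⟩ := h
  exact Finset.one_lt_card.mpr ⟨g, hg, g', hg', TwoStar.edges_ne hne h1 h2⟩

/-- The star exhausts `S`, and its two edges meet in one vertex only. -/
theorem TwoStar.centre_unique {S : Finset β} (hS : S.card ≤ 2) {o o' : α} {p q : Sym2 α}
    (h : TwoStar ε S o p q) (h' : TwoStar ε S o' p q) : o = o' := by
  obtain ⟨y, z, rfl, rfl, hne, g, hg, g', hg', h1, h2⟩ := h
  obtain ⟨y', z', hy, hz, -, k, hk, k', hk', h3, h4⟩ := h'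
  obtain rfl : y = y' := by simpa using hy
  obtain rfl : z = z' := by simpa using hz
  have hgg := TwoStar.edges_ne hne h1 h2
  have hSeq : S = {g, g'} := by
    refine (Finset.eq_of_subset_of_card_le ?_ ?_).symm
    · intro x hx
      simp only [Finset.mem_insert, Finset.mem_singleton] at hx
      rcases hx with rfl | rfl <;> assumption
    · rw [Finset.card_pair hgg]; exact hS
  rw [hSeq] at hk hk'
  simp only [Finset.mem_insert, Finset.mem_singleton] at hk hk'
  rcases hk with rfl | rfl
  · rw [h1] at h3
    rcases Sym2.eq_iff.mp h3 with ⟨h, -⟩ | ⟨h, h'⟩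
    · exact h
    · exact h.trans h'
  · rcases hk' with rfl | rfl
    · rw [h2] at h3
      rw [h1] at h4
      rcases Sym2.eq_iff.mp h3 with ⟨h, -⟩ | ⟨h, h'⟩
      · exact h
      · rcases Sym2.eq_iff.mp h4 with ⟨h5, -⟩ | ⟨h5, h6⟩
        · exact h5
        · exact absurd (h.symm.trans h5) hne
    · exact absurd rfl (TwoStar.edges_ne hne h3 h4)

/-- Any vertex and any two pairs of `C` admit a detour unless they form a star of singular edges. -/
def LinkTwo (ε : β → Sym2 α) (c : β → κ) (C : Piece α β) : Prop :=
  ∀ (o : α) (p q : Sym2 α), o ∈ C.verts → (∀ v ∈ p, v ∈ C.verts) → (∀ v ∈ q, v ∈ C.verts) →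
    Detour ε c C.edges C.verts.card o p q ∨ TwoStar ε C.singular o p q

theorem LinkTwo.detour_of_ne (h : LinkTwo ε c C) {o x y : α} {q : Sym2 α} (ho : o ∈ C.verts)
    (hx : x ∈ C.verts) (hy : y ∈ C.verts) (hxy : x ≠ y) (hq : ∀ v ∈ q, v ∈ C.verts) :
    Detour ε c C.edges C.verts.card o s(x, y) q := by
  rcases h o s(x, y) q ho (by
    simp only [Sym2.mem_iff, forall_eq_or_imp, forall_eq]
    exact ⟨hx, hy⟩) hq with h | ⟨u, z, h1, -⟩
  · exact h
  · rcases Sym2.eq_iff.mp h1 with ⟨rfl, rfl⟩ | ⟨rfl, rfl⟩ <;> exact absurd rfl hxy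

theorem IsMerge.detour_extend (h : IsMerge ε c A B C e f a b a' b') (hA : Cluster ε c A)
    (hB : Cluster ε c B) {p q : Sym2 α} {y : α} (hy : y ∈ B.verts)
    (hd : Detour ε c A.edges A.verts.card a p q) : Detour ε c C.edges C.verts.card y p q := by
  have hcard := h.card_verts
  have hpos := hA.card_pos
  rcases hd with ⟨z, hz, hl⟩ | ⟨z, hz, hl⟩
  · exact Or.inl ⟨z, hz, h.linked_extend hB hl hy (by omega)⟩
  · exact Or.inr ⟨z, hz, h.linked_extend hB hl hy (by omega)⟩

/-- Two different attachment vertices cannot both be exceptional. -/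
theorem IsMerge.detour_of_rank_le_two (h : IsMerge ε c A B C e f a b a' b') (hA : Cluster ε c A)
    (hB : Cluster ε c B) (hr : A.rank ≤ 2) (ih : LinkTwo ε c A) {p q : Sym2 α} {y : α}
    (hy : y ∈ B.verts) (hp : ∀ v ∈ p, v ∈ A.verts) (hq : ∀ v ∈ q, v ∈ A.verts) :
    Detour ε c C.edges C.verts.card y p q ∨ (a = a' ∧ TwoStar ε A.singular a p q) := by
  rcases ih a p q h.left_mem hp hq with h1 | h1
  · exact Or.inl (h.detour_extend hA hB hy h1)
  · rcases ih a' p q h.left_mem' hp hq with h2 | h2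
    · exact Or.inl (h.swap.detour_extend hA hB hy h2)
    · exact Or.inr ⟨h1.centre_unique (hA.card_singular_le.trans hr) h2, h1⟩

/-- An obstructing star takes up rank two in `A` and forces `a = a'`. The merge then adds rank
itself, or has distinct ends in `B` and so positive rank there; either way the total exceeds two. -/
theorem IsMerge.linkTwo_apart (h : IsMerge ε c A B C e f a b a' b') (hA : Cluster ε c A)
    (hB : Cluster ε c B) (hr : C.rank ≤ 2) (ih : A.rank ≤ 2 → LinkTwo ε c A) {o : α}
    {p q : Sym2 α} (ho : o ∈ B.verts) (hp : ∀ v ∈ p, v ∈ A.verts) (hq : ∀ v ∈ q, v ∈ A.verts) :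
    Detour ε c C.edges C.verts.card o p q := by
  have hrA : A.rank ≤ 2 := by
    rcases h.single_or_double with ⟨-, -, -, -, h5⟩ | ⟨-, -, -, h5⟩ <;> omega
  rcases h.detour_of_rank_le_two hA hB hrA (ih hrA) ho hp hq with h1 | ⟨haa, h1⟩
  · exact h1
  · have h2 := h1.two_le
    have h3 := hA.card_singular_le
    rcases h.single_or_double with ⟨-, -, -, -, h5⟩ | ⟨-, h4, -, h5⟩
    · omega
    · have := hB.rank_pos h.right_mem h.right_mem' (h4.resolve_left fun h => h haa)
      omega

/-- With an attachment vertex `u ≠ x`, the pair `s(x, y)` is traded for `s(u, x)` inside `A`, and a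
connection ending at `u` is prolonged to `y`. If both attachment vertices are `x`, then `A` has rank
at most one and `q` is linked directly to `o` and `x`. -/
theorem IsMerge.linkTwo_split (h : IsMerge ε c A B C e f a b a' b') (hA : Cluster ε c A)
    (hB : Cluster ε c B) (hr : C.rank ≤ 2) (ih : A.rank ≤ 2 → LinkTwo ε c A) {o x y : α}
    {q : Sym2 α} (ho : o ∈ A.verts) (hx : x ∈ A.verts) (hy : y ∈ B.verts) (hox : o ≠ x)
    (hq : ∀ v ∈ q, v ∈ A.verts) : Detour ε c C.edges C.verts.card o s(x, y) q := by
  have hcard := h.card_verts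
  have hpos := hA.card_pos
  have aux : ∀ {g g' : β} {u w u' w' : α}, IsMerge ε c A B C g g' u w u' w' → u ≠ x →
      Detour ε c C.edges C.verts.card o s(x, y) q := by
    intro g g' u w u' w' h hux
    have hrA : A.rank ≤ 2 := by
      rcases h.single_or_double with ⟨-, -, -, -, h5⟩ | ⟨-, -, -, h5⟩ <;> omega
    rcases (ih hrA).detour_of_ne ho h.left_mem hx hux hq with ⟨z, hz, hl⟩ | ⟨z, hz, hl⟩
    · rw [diagonal_of_ne hux] at hl
      refine Or.inl ⟨z, hz, ?_⟩
      rw [Sym2.eq_swap (a := x)]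
      exact (h.linked_extend hB hl.symm hy (N := C.verts.card - 1) (by omega)).symm.mono
        subset_rfl (by omega)
    · refine Or.inr ?_
      rcases Sym2.mem_iff.mp hz with rfl | rfl
      · rw [Sym2.eq_swap] at hl
        refine ⟨y, by simp, ?_⟩
        rw [Sym2.eq_swap]
        exact h.linked_extend hB hl hy (by omega)
      · exact ⟨z, by simp, hl.mono h.left_edges (by omega)⟩
  by_cases hax : a = x
  · by_cases hax' : a' = x
    · have hrA : A.rank ≤ 1 := by
        rcases h.single_or_double with ⟨-, -, -, -, h5⟩ | ⟨-, h4, -, h5⟩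
        · omega
        · have := hB.rank_pos h.right_mem h.right_mem'
            (h4.resolve_left fun h => h (hax.trans hax'.symm))
          omega
      exact Or.inr ⟨x, by simp, (hA.linked_of_ne hrA hq ho hx hox).mono h.left_edges (by omega)⟩
    · exact aux h.swap hax'
  · exact aux h hax

/-- The star arises only from a single merge at `a = o`: its edge joins `o` to the one vertex of
`B`, and the exception of `linkOne` in `A` supplies the second singular edge at `o`. -/
theorem IsMerge.linkTwo_beside (h : IsMerge ε c A B C e f a b a' b') (hA : Cluster ε c A)
    (hB : Cluster ε c B) (hr : C.rank ≤ 2) (ih : A.rank ≤ 2 → LinkTwo ε c A) {o : α}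
    {p q : Sym2 α} (ho : o ∈ A.verts) (hp : ∀ v ∈ p, v ∈ B.verts)
    (hq : ∀ v ∈ q, v ∈ A.verts) (hoq : o ∉ q) :
    Detour ε c C.edges C.verts.card o p q ∨ TwoStar ε C.singular o p q := by
  have hcard := h.card_verts
  have hposA := hA.card_pos
  have hposB := hB.card_pos
  obtain ⟨z, hz⟩ := exists_mem_pair q
  obtain ⟨y, hy⟩ := exists_mem_pair p
  have hoz : o ≠ z := fun h => hoq (h ▸ hz)
  have hA2 : 2 ≤ A.verts.card := Finset.one_lt_card.mpr ⟨o, ho, z, hq z hz, hoz⟩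
  have hrA1 : 1 ≤ A.rank := hA.rank_pos ho (hq z hz) hoz
  have toB : ∀ {g g' : β} {u w u' w' : α}, IsMerge ε c A B C g g' u w u' w' →
      Linked ε c A.edges q s(o, u) (A.verts.card + diagonal q - 1) →
      Detour ε c C.edges C.verts.card o p q := by
    intro g g' u w u' w' h hl
    rw [Sym2.eq_swap] at hl
    refine Or.inr ⟨y, hy, ?_⟩
    rw [Sym2.eq_swap]
    exact h.linked_extend hB hl (hp y hy) (by omega)
  by_cases hrA : A.rank ≤ 1
  · have near : ∀ {g g' : β} {u w u' w' : α}, IsMerge ε c A B C g g' u w u' w' → o ≠ u →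
        Detour ε c C.edges C.verts.card o p q := by
      intro g g' u w u' w' h hou
      exact toB h ((hA.linked_of_ne hrA hq ho h.left_mem hou).mono subset_rfl (by omega))
    by_cases hoa : o = a
    · by_cases hoa' : o = a'
      · subst hoa
        rcases h.single_or_double with ⟨-, -, -, h4, h5⟩ | ⟨hef, h2, -, h5⟩
        · have heB : ∀ v ∈ B.verts, v = b := fun v hv =>
            hB.eq_of_rank_eq_zero (by omega) hv h.right_mem
          rcases hA.linkOne hrA q s(o, o) hq (by simpa using ho) with hl | ⟨u, x, h6, h7, g, hg, h8⟩
          · rw [diagonal_self] at hl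
            exact Or.inl (toB h (hl.mono subset_rfl (by omega)))
          · obtain rfl : o = x := by simpa using h7
            refine Or.inr ⟨b, u, pair_eq_self fun v hv => heB v (hp v hv), h6, ?_, e, ?_, g,
              h.left_singular hg, h.ends, h8.trans Sym2.eq_swap⟩
            · rintro rfl
              exact Finset.disjoint_left.mp h.disj (hq b (by simp [h6])) h.right_mem
            · rw [h4]; simp
        · have hbb := h2.resolve_left fun h => h hoa'
          have hrB := hB.rank_pos h.right_mem h.right_mem' hbb
          have h6 := hB.linked_of_ne (by omega) hp h.right_mem h.right_mem' hbb
          have h7 : Linked ε c A.edges s(o, z) s(o, a') (A.verts.card - 1) :=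
            hA.linked_of_common (hq z hz) h.left_mem' (by omega)
          refine Or.inl (Or.inl ⟨z, hz, (h.linked_cross hef h7 h6 ?_).symm⟩)
          have : 2 ≤ B.verts.card :=
            Finset.one_lt_card.mpr ⟨b, h.right_mem, b', h.right_mem', hbb⟩
          omega
      · exact Or.inl (near h.swap hoa')
    · exact Or.inl (near h hoa)
  · rcases h.single_or_double with ⟨-, -, -, h4, h5⟩ | ⟨hef, h2, -, h5⟩
    · omega
    · have hB0 : B.rank = 0 := by omega
      have heB : ∀ v ∈ B.verts, v = b := fun v hv => hB.eq_of_rank_eq_zero hB0 hv h.right_mem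
      obtain rfl := pair_eq_self fun v hv => heB v (hp v hv)
      obtain rfl := heB b' h.right_mem'
      have haa : a ≠ a' := h2.resolve_right fun h => h rfl
      have hB1 := hB.card_eq_one hB0
      -- The single vertex of `B` is traded for the pair of its two neighbours.
      rcases (ih (by omega)).detour_of_ne ho h.left_mem h.left_mem' haa hq with
        ⟨z, hz, hl⟩ | ⟨z, hz, hl⟩
      · rw [diagonal_of_ne haa] at hl
        refine Or.inl (Or.inl ⟨z, hz, (h.linked_cross hef hl.symm (hB.linked_of_common (N := 0)
          h.right_mem h.right_mem (by omega)) ?_).symm⟩)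
        simp only [diagonal_self]
        omega
      · rcases Sym2.mem_iff.mp hz with rfl | rfl
        · exact Or.inl (toB h hl)
        · exact Or.inl (toB h.swap hl)

theorem IsMerge.linkTwo_of_left (h : IsMerge ε c A B C e f a b a' b') (hA : Cluster ε c A)
    (hB : Cluster ε c B) (hr : C.rank ≤ 2) (ihA : A.rank ≤ 2 → LinkTwo ε c A)
    (ihB : B.rank ≤ 2 → LinkTwo ε c B) {o : α} {p q : Sym2 α} (ho : o ∈ A.verts)
    (hp : ∀ v ∈ p, v ∈ C.verts) (hq : ∀ v ∈ q, v ∈ C.verts) (hop : o ∉ p) (hoq : o ∉ q) :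
    Detour ε c C.edges C.verts.card o p q ∨ TwoStar ε C.singular o p q := by
  have hcard := h.card_verts
  have hposA := hA.card_pos
  have hrA : A.rank ≤ 2 := by
    rcases h.single_or_double with ⟨-, -, -, -, h5⟩ | ⟨-, -, -, h5⟩ <;> omega
  rcases h.pair_cases hp with hp | hp | ⟨x, hx, y, hy, rfl⟩ <;>
    rcases h.pair_cases hq with hq | hq | ⟨x', hx', y', hy', rfl⟩
  · rcases ihA hrA o p q ho hp hq with (⟨z, hz, hl⟩ | ⟨z, hz, hl⟩) | h1
    · exact Or.inl (Or.inl ⟨z, hz, hl.mono h.left_edges (by omega)⟩)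
    · exact Or.inl (Or.inr ⟨z, hz, hl.mono h.left_edges (by omega)⟩)
    · exact Or.inr (h1.mono h.left_singular)
  · exact (h.linkTwo_beside hA hB hr ihA ho hq hp hop).imp Detour.symm TwoStar.symm
  · exact Or.inl (h.linkTwo_split hA hB hr ihA ho hx' hy'
      (fun h => hoq (by simp [h])) hp).symm
  · exact h.linkTwo_beside hA hB hr ihA ho hp hq hoq
  · exact Or.inl (h.symm.linkTwo_apart hB hA hr ihB ho hp hq)
  · obtain ⟨y, hy⟩ := exists_mem_pair p
    exact Or.inl (Or.inr ⟨y, hy, h.linked_parallel hA hB hx' ho hy' (hp y hy) (by omega)⟩)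
  · exact Or.inl (h.linkTwo_split hA hB hr ihA ho hx hy (fun h => hop (by simp [h])) hq)
  · obtain ⟨z, hz⟩ := exists_mem_pair q
    exact Or.inl (Or.inl ⟨z, hz, h.linked_parallel hA hB hx ho hy (hq z hz) (by omega)⟩)
  · exact Or.inl (Or.inl ⟨y', by simp, h.linked_parallel hA hB hx ho hy hy' (by omega)⟩)

theorem Cluster.linkTwo (h : Cluster ε c C) (hr : C.rank ≤ 2) : LinkTwo ε c C := by
  have common : ∀ {C : Piece α β}, Cluster ε c C → ∀ (o : α) (p q : Sym2 α),
      (∀ v ∈ p, v ∈ C.verts) → (∀ v ∈ q, v ∈ C.verts) → o ∈ p →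
      Detour ε c C.edges C.verts.card o p q := by
    intro C hC o p q hp hq hop
    obtain ⟨y, rfl⟩ := hop
    obtain ⟨z, hz⟩ := exists_mem_pair q
    exact Or.inl ⟨z, hz, hC.linked_of_common (hp y (by simp)) (hq z hz) (by omega)⟩
  induction h with
  | leaf v =>
    intro o p q ho hp hq
    refine Or.inl (common (Cluster.leaf v) o p q hp hq ?_)
    obtain ⟨y, hy⟩ := exists_mem_pair p
    rwa [Finset.mem_singleton.mp ho, ← Finset.mem_singleton.mp (hp y hy)]
  | @merge A B C e f a b a' b' hA hB hm ihA ihB =>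
    intro o p q ho hp hq
    have hC := Cluster.merge hA hB hm
    by_cases hop : o ∈ p
    · exact Or.inl (common hC o p q hp hq hop)
    by_cases hoq : o ∈ q
    · exact Or.inl (common hC o q p hq hp hoq).symm
    rw [hm.verts_eq, Finset.mem_union] at ho
    rcases ho with ho | ho
    · exact hm.linkTwo_of_left hA hB hr ihA ihB ho hp hq hop hoq
    · exact hm.symm.linkTwo_of_left hB hA hr ihB ihA ho hp hq hop hoq

end RainbowLinkage

namespace RainbowLinkage

variable {α β κ : Type*} [DecidableEq α] [DecidableEq β] [DecidableEq κ]
variable {ε : β → Sym2 α} {c : β → κ} {A B C : Piece α β} {e f : β} {a b a' b' : α}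

/-! ### At most three singular edges -/

/-- One of three pairs can be linked by few edges to vertices of the two other pairs. -/
def Tripod (ε : β → Sym2 α) (c : β → κ) (E : Finset β) (n : ℕ) (p q r : Sym2 α) : Prop :=
  (∃ y ∈ q, ∃ z ∈ r, Linked ε c E p s(y, z) (n + diagonal p - 1)) ∨
  (∃ z ∈ r, ∃ x ∈ p, Linked ε c E q s(z, x) (n + diagonal q - 1)) ∨
  (∃ x ∈ p, ∃ y ∈ q, Linked ε c E r s(x, y) (n + diagonal r - 1))

/-- The pairs are degenerate, and some vertex is joined to all of them by edges of `S`. -/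
def ThreeStar (ε : β → Sym2 α) (S : Finset β) (p q r : Sym2 α) : Prop :=
  ∃ o x y z, p = s(x, x) ∧ q = s(y, y) ∧ r = s(z, z) ∧
    ∃ g₁ ∈ S, ∃ g₂ ∈ S, ∃ g₃ ∈ S, ε g₁ = s(o, x) ∧ ε g₂ = s(o, y) ∧ ε g₃ = s(o, z)

/-- The alternative for three pairs of `C`: they can be linked, or they form a star. -/
def TripodOrStar (ε : β → Sym2 α) (c : β → κ) (C : Piece α β) (p q r : Sym2 α) : Prop :=
  Tripod ε c C.edges C.verts.card p q r ∨ ThreeStar ε C.singular p q r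

theorem TripodOrStar.rotate {p q r : Sym2 α} (h : TripodOrStar ε c C p q r) :
    TripodOrStar ε c C q r p := by
  rcases h with (h | h | h) | ⟨o, x, y, z, hp, hq, hr, g₁, h1, g₂, h2, g₃, h3, h4, h5, h6⟩
  · exact Or.inl (Or.inr (Or.inr h))
  · exact Or.inl (Or.inl h)
  · exact Or.inl (Or.inr (Or.inl h))
  · exact Or.inr ⟨o, y, z, x, hq, hr, hp, g₂, h2, g₃, h3, g₁, h1, h5, h6, h4⟩

theorem IsMerge.tripod_parallel (h : IsMerge ε c A B C e f a b a' b') (hA : Cluster ε c A)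
    (hB : Cluster ε c B) {x y u v : α} {q r : Sym2 α} (hx : x ∈ A.verts) (hy : y ∈ B.verts)
    (hu : u ∈ q) (hv : v ∈ r) (huv : (u ∈ A.verts ∧ v ∈ B.verts) ∨ (u ∈ B.verts ∧ v ∈ A.verts)) :
    TripodOrStar ε c C s(x, y) q r := by
  have hcard := h.card_verts
  have hposA := hA.card_pos
  refine Or.inl (Or.inl ⟨u, hu, v, hv, ?_⟩)
  rcases huv with ⟨h1, h2⟩ | ⟨h1, h2⟩
  · exact h.linked_parallel hA hB hx h1 hy h2 (by omega)
  · rw [Sym2.eq_swap (a := u)]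
    exact h.linked_parallel hA hB hx h2 hy h1 (by omega)

theorem Detour.tripodOrStar {p q r : Sym2 α} {x : α} (hx : x ∈ p)
    (h : Detour ε c C.edges C.verts.card x q r) : TripodOrStar ε c C p q r := by
  rcases h with ⟨z, hz, hl⟩ | ⟨y, hy, hl⟩
  · rw [Sym2.eq_swap] at hl
    exact Or.inl (Or.inr (Or.inl ⟨z, hz, x, hx, hl⟩))
  · exact Or.inl (Or.inr (Or.inr ⟨x, hx, y, hy, hl⟩))

/-- The three pairs of `C` can be linked by few edges unless they form a star of singular edges. -/
def LinkThree (ε : β → Sym2 α) (c : β → κ) (C : Piece α β) : Prop :=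
  ∀ p q r : Sym2 α, (∀ v ∈ p, v ∈ C.verts) → (∀ v ∈ q, v ∈ C.verts) → (∀ v ∈ r, v ∈ C.verts) →
    TripodOrStar ε c C p q r

theorem LinkThree.tripod_of_ne (h : LinkThree ε c C) {x y : α} {q r : Sym2 α}
    (hx : x ∈ C.verts) (hy : y ∈ C.verts) (hxy : x ≠ y) (hq : ∀ v ∈ q, v ∈ C.verts)
    (hr : ∀ v ∈ r, v ∈ C.verts) : Tripod ε c C.edges C.verts.card s(x, y) q r := by
  rcases h s(x, y) q r (by
    simp only [Sym2.mem_iff, forall_eq_or_imp, forall_eq]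
    exact ⟨hx, hy⟩) hq hr with h | ⟨o, u, -, -, h1, -⟩
  · exact h
  · rcases Sym2.eq_iff.mp h1 with ⟨rfl, rfl⟩ | ⟨rfl, rfl⟩ <;> exact absurd rfl hxy

/-- The star that obstructs a detour is itself a linkage from its centre with only two edges, which
rescues the rank-three cases. -/
theorem Cluster.linked_of_twoStar (h : Cluster ε c C) {o y z : α}
    (hs : TwoStar ε C.singular o s(y, y) s(z, z)) : Linked ε c C.edges s(o, o) s(y, z) 2 := by
  obtain ⟨y', z', hy, hz, hne, g, hg, g', hg', h1, h2⟩ := hs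
  obtain rfl : y = y' := by simpa using hy
  obtain rfl : z = z' := by simpa using hz
  have hgg := TwoStar.edges_ne hne h1 h2
  exact ⟨o, o, y, z, rfl, rfl, {g}, {g'}, RainbowConn.edge (h.singular_subset hg) h1,
    RainbowConn.edge (h.singular_subset hg') h2, by simpa using hgg, by simp⟩

theorem TwoStar.exists_eq {S : Finset β} {o : α} {p q : Sym2 α} (h : TwoStar ε S o p q) :
    ∃ y z, p = s(y, y) ∧ q = s(z, z) := by
  obtain ⟨y, z, hp, hq, -⟩ := h
  exact ⟨y, z, hp, hq⟩

/-- By `card_edges`, two vertices with this rank would leave no edges, although clusters are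
connected. The third vertex makes room for the two star edges in the bounds. -/
theorem Cluster.three_le_card_of_rank (h : Cluster ε c C) (hr : 2 ≤ C.rank) :
    3 ≤ C.verts.card := by
  have h1 := h.card_edges
  by_contra h2
  have h3 := h.card_pos
  have h4 : C.verts.card = 2 ∧ C.edges.card = 0 := by omega
  obtain ⟨u, v, huv, hV⟩ := Finset.card_eq_two.mp h4.1
  obtain ⟨P, hP, -⟩ := h.exists_rainbowConn (u := u) (v := v) (by simp [hV]) (by simp [hV])
  have hP0 : P = ∅ := Finset.subset_empty.mp (Finset.card_eq_zero.mp h4.2 ▸ hP.1)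
  subst hP0
  rcases Relation.ReflTransGen.cases_head hP.2.2 with h5 | ⟨w, ⟨g, hg, -⟩, -⟩
  · exact huv h5
  · simp at hg

/-- As in `linkTwo_split`, unless both attachment vertices are `x`. Then `A` has rank at most two
and a detour ending at `y` is sought; an obstructing star is centred at `x` and links `s(x, y)` to
`q` and `r` after prolonging one arm to `y`. -/
theorem IsMerge.linkThree_split (h : IsMerge ε c A B C e f a b a' b') (hA : Cluster ε c A)
    (hB : Cluster ε c B) (hr : C.rank ≤ 3) (ih : A.rank ≤ 3 → LinkThree ε c A) {x y : α}
    {q r : Sym2 α} (hx : x ∈ A.verts) (hy : y ∈ B.verts) (hq : ∀ v ∈ q, v ∈ A.verts)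
    (hr' : ∀ v ∈ r, v ∈ A.verts) : TripodOrStar ε c C s(x, y) q r := by
  have hcard := h.card_verts
  have hposA := hA.card_pos
  have hposB := hB.card_pos
  have hxy : x ≠ y := fun hxy => Finset.disjoint_left.mp h.disj hx (hxy ▸ hy)
  have aux : ∀ {g g' : β} {u w u' w' : α}, IsMerge ε c A B C g g' u w u' w' → u ≠ x →
      TripodOrStar ε c C s(x, y) q r := by
    intro g g' u w u' w' h hux
    have hrA : A.rank ≤ 3 := by
      rcases h.single_or_double with ⟨-, -, -, -, h5⟩ | ⟨-, -, -, h5⟩ <;> omega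
    rcases (ih hrA).tripod_of_ne h.left_mem hx hux hq hr' with
      ⟨v, hv, z, hz, hl⟩ | ⟨z, hz, v, hv, hl⟩ | ⟨v, hv, z, hz, hl⟩
    · rw [diagonal_of_ne hux] at hl
      refine Or.inl (Or.inl ⟨v, hv, z, hz, ?_⟩)
      rw [Sym2.eq_swap (a := x), diagonal_of_ne hxy.symm]
      exact (h.linked_extend hB hl.symm hy (by omega)).symm
    · rw [Sym2.eq_swap] at hl
      rcases Sym2.mem_iff.mp hv with rfl | rfl
      · refine Or.inl (Or.inr (Or.inl ⟨z, hz, y, by simp, ?_⟩))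
        rw [Sym2.eq_swap]
        exact h.linked_extend hB hl hy (by omega)
      · refine Or.inl (Or.inr (Or.inl ⟨z, hz, v, by simp, ?_⟩))
        rw [Sym2.eq_swap]
        exact hl.mono h.left_edges (by omega)
    · rcases Sym2.mem_iff.mp hv with rfl | rfl
      · exact Or.inl (Or.inr (Or.inr ⟨y, by simp, z, hz, h.linked_extend hB hl hy (by omega)⟩))
      · exact Or.inl (Or.inr (Or.inr ⟨v, by simp, z, hz, hl.mono h.left_edges (by omega)⟩))
  by_cases hax : a = x
  · by_cases hax' : a' = x
    · subst hax
      have hrA : A.rank ≤ 2 := by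
        rcases h.single_or_double with ⟨-, -, -, -, h5⟩ | ⟨-, h4, -, h5⟩
        · omega
        · have := hB.rank_pos h.right_mem h.right_mem' (h4.resolve_left fun h => h hax'.symm)
          omega
      rcases h.detour_of_rank_le_two hA hB hrA (hA.linkTwo hrA) hy hq hr' with h1 | ⟨-, h1⟩
      · exact h1.tripodOrStar (by simp)
      · have hA3 := hA.three_le_card_of_rank (h1.two_le.trans hA.card_singular_le)
        obtain ⟨v, z, rfl, rfl⟩ := h1.exists_eq
        refine Or.inl (Or.inl ⟨v, by simp, z, by simp, ?_⟩)
        rw [Sym2.eq_swap (a := a)]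
        exact (h.linked_extend hB (hA.linked_of_twoStar h1).symm hy (by omega)).symm
    · exact aux h.swap hax'
  · exact aux h hax

/-- If `A` has rank at most two and a star at `a` blocks the detour, a single merge enlarges it to a
star with three edges, while a double merge leaves the centre by two edges into distinct vertices of
`B`. If `A` has rank three, `B` is one vertex and is traded for `s(a, a')`. -/
theorem IsMerge.linkThree_beside (h : IsMerge ε c A B C e f a b a' b') (hA : Cluster ε c A)
    (hB : Cluster ε c B) (hr : C.rank ≤ 3) (ih : A.rank ≤ 3 → LinkThree ε c A)
    {p q r : Sym2 α} (hp : ∀ v ∈ p, v ∈ B.verts) (hq : ∀ v ∈ q, v ∈ A.verts)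
    (hr' : ∀ v ∈ r, v ∈ A.verts) : TripodOrStar ε c C p q r := by
  have hcard := h.card_verts
  have hposA := hA.card_pos
  have hposB := hB.card_pos
  obtain ⟨x, hx⟩ := exists_mem_pair p
  by_cases hrA : A.rank ≤ 2
  · rcases h.detour_of_rank_le_two hA hB hrA (hA.linkTwo hrA) (hp x hx) hq hr' with h1 | ⟨haa, h1⟩
    · exact h1.tripodOrStar hx
    · have h2 := h1.two_le.trans hA.card_singular_le
      have hA3 := hA.three_le_card_of_rank h2
      obtain ⟨y, z, rfl, rfl⟩ := h1.exists_eq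
      rcases h.single_or_double with ⟨-, -, -, h4, h5⟩ | ⟨hef, h4, -, h5⟩
      · have heB : ∀ v ∈ B.verts, v = b := fun v hv =>
          hB.eq_of_rank_eq_zero (by omega) hv h.right_mem
        obtain ⟨y', z', hy, hz, hne, g, hg, g', hg', h6, h7⟩ := h1
        exact Or.inr ⟨a, b, y', z', pair_eq_self fun v hv => heB v (hp v hv), hy, hz, e,
          by rw [h4]; simp, g, h.left_singular hg, g', h.left_singular hg', h.ends, h6, h7⟩
      · have hbb := h4.resolve_left fun h => h haa
        have hrB := hB.rank_pos h.right_mem h.right_mem' hbb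
        have h6 := hB.linked_of_ne (by omega) hp h.right_mem h.right_mem' hbb
        have h7 := (hA.linked_of_twoStar h1).symm
        have hB2 : 2 ≤ B.verts.card :=
          Finset.one_lt_card.mpr ⟨b, h.right_mem, b', h.right_mem', hbb⟩
        rw [← haa] at h
        exact Or.inl (Or.inl ⟨y, by simp, z, by simp, (h.linked_cross hef h7 h6 (by omega)).symm⟩)
  · rcases h.single_or_double with ⟨-, -, -, -, h5⟩ | ⟨hef, h4, -, h5⟩
    · omega
    · have hB0 : B.rank = 0 := by omega
      have heB : ∀ v ∈ B.verts, v = b := fun v hv => hB.eq_of_rank_eq_zero hB0 hv h.right_mem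
      obtain rfl := pair_eq_self fun v hv => heB v (hp v hv)
      obtain rfl := heB b' h.right_mem'
      have haa : a ≠ a' := h4.resolve_right fun h => h rfl
      have hB1 := hB.card_eq_one hB0
      rcases (ih (by omega)).tripod_of_ne h.left_mem h.left_mem' haa hq hr' with
        ⟨y, hy, z, hz, hl⟩ | ⟨z, hz, y, hy, hl⟩ | ⟨y, hy, z, hz, hl⟩
      · rw [diagonal_of_ne haa] at hl
        refine Or.inl (Or.inl ⟨y, hy, z, hz, (h.linked_cross hef hl.symm (hB.linked_of_common
          (N := 0) h.right_mem h.right_mem (by omega)) ?_).symm⟩)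
        simp only [diagonal_self]
        omega
      · rw [Sym2.eq_swap] at hl
        refine Or.inl (Or.inr (Or.inl ⟨z, hz, b', by simp, ?_⟩))
        rw [Sym2.eq_swap]
        rcases Sym2.mem_iff.mp hy with rfl | rfl
        · exact h.linked_extend hB hl h.right_mem (by omega)
        · exact h.swap.linked_extend hB hl h.right_mem (by omega)
      · refine Or.inl (Or.inr (Or.inr ⟨b', by simp, z, hz, ?_⟩))
        rcases Sym2.mem_iff.mp hy with rfl | rfl
        · exact h.linked_extend hB hl h.right_mem (by omega)
        · exact h.swap.linked_extend hB hl h.right_mem (by omega)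

/-- The case of `LinkThree` in which the first pair is split. -/
theorem IsMerge.linkThree_of_split (h : IsMerge ε c A B C e f a b a' b') (hA : Cluster ε c A)
    (hB : Cluster ε c B) (hr : C.rank ≤ 3) (ihA : A.rank ≤ 3 → LinkThree ε c A)
    (ihB : B.rank ≤ 3 → LinkThree ε c B) {x y : α} {q r : Sym2 α} (hx : x ∈ A.verts)
    (hy : y ∈ B.verts) (hq : ∀ v ∈ q, v ∈ C.verts) (hr' : ∀ v ∈ r, v ∈ C.verts) :
    TripodOrStar ε c C s(x, y) q r := by
  obtain ⟨u, hu⟩ := exists_mem_pair q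
  obtain ⟨v, hv⟩ := exists_mem_pair r
  have hv' := hr' v hv
  have hu' := hq u hu
  rw [h.verts_eq, Finset.mem_union] at hu' hv'
  rcases h.pair_cases hq with hq | hq | ⟨x', hx', y', hy', rfl⟩
  · rcases h.pair_cases hr' with hr' | hr' | ⟨x'', hx'', y'', hy'', rfl⟩
    · exact h.linkThree_split hA hB hr ihA hx hy hq hr'
    · exact h.tripod_parallel hA hB hx hy hu hv (Or.inl ⟨hq u hu, hr' v hv⟩)
    · exact h.tripod_parallel hA hB hx hy hu (Sym2.mem_mk_right x'' y'') (Or.inl ⟨hq u hu, hy''⟩)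
  · rcases h.pair_cases hr' with hr' | hr' | ⟨x'', hx'', y'', hy'', rfl⟩
    · exact h.tripod_parallel hA hB hx hy hu hv (Or.inr ⟨hq u hu, hr' v hv⟩)
    · rw [Sym2.eq_swap]
      exact h.symm.linkThree_split hB hA hr ihB hy hx hq hr'
    · exact h.tripod_parallel hA hB hx hy hu (Sym2.mem_mk_left x'' y'') (Or.inr ⟨hq u hu, hx''⟩)
  · rcases hv' with hv' | hv'
    · exact h.tripod_parallel hA hB hx hy (Sym2.mem_mk_right x' y') hv (Or.inr ⟨hy', hv'⟩)
    · exact h.tripod_parallel hA hB hx hy (Sym2.mem_mk_left x' y') hv (Or.inl ⟨hx', hv'⟩)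

theorem IsMerge.linkThree_inside (h : IsMerge ε c A B C e f a b a' b')
    (hr : C.rank ≤ 3) (ihA : A.rank ≤ 3 → LinkThree ε c A) {p q r : Sym2 α}
    (hp : ∀ v ∈ p, v ∈ A.verts) (hq : ∀ v ∈ q, v ∈ A.verts) (hr' : ∀ v ∈ r, v ∈ A.verts) :
    TripodOrStar ε c C p q r := by
  have hcard := h.card_verts
  have hrA : A.rank ≤ 3 := by
    rcases h.single_or_double with ⟨-, -, -, -, h5⟩ | ⟨-, -, -, h5⟩ <;> omega
  rcases ihA hrA p q r hp hq hr' with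
    (⟨y, hy, z, hz, hl⟩ | ⟨y, hy, z, hz, hl⟩ | ⟨y, hy, z, hz, hl⟩) |
    ⟨o, x, y, z, hp, hq, hr, g₁, h1, g₂, h2, g₃, h3, h4⟩
  · exact Or.inl (Or.inl ⟨y, hy, z, hz, hl.mono h.left_edges (by omega)⟩)
  · exact Or.inl (Or.inr (Or.inl ⟨y, hy, z, hz, hl.mono h.left_edges (by omega)⟩))
  · exact Or.inl (Or.inr (Or.inr ⟨y, hy, z, hz, hl.mono h.left_edges (by omega)⟩))
  · exact Or.inr ⟨o, x, y, z, hp, hq, hr, g₁, h.left_singular h1, g₂, h.left_singular h2, g₃,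
      h.left_singular h3, h4⟩

theorem Cluster.linkThree (h : Cluster ε c C) (hr : C.rank ≤ 3) : LinkThree ε c C := by
  induction h with
  | leaf v =>
    intro p q r hp hq hr'
    obtain rfl := pair_eq_self fun w hw => Finset.mem_singleton.mp (hp w hw)
    obtain rfl := pair_eq_self fun w hw => Finset.mem_singleton.mp (hq w hw)
    obtain rfl := pair_eq_self fun w hw => Finset.mem_singleton.mp (hr' w hw)
    exact Or.inl (Or.inl ⟨v, by simp, v, by simp,
      (Cluster.leaf v).linked_of_common (by simp) (by simp) (by simp)⟩)
  | @merge A B C e f a b a' b' hA hB hm ihA ihB =>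
    intro p q r hp hq hr'
    rcases hm.pair_cases hp with hp' | hp' | ⟨x, hx, y, hy, rfl⟩
    · rcases hm.pair_cases hq with hq' | hq' | ⟨x, hx, y, hy, rfl⟩
      · rcases hm.pair_cases hr' with hr'' | hr'' | ⟨x, hx, y, hy, rfl⟩
        · exact hm.linkThree_inside hr ihA hp' hq' hr''
        · exact (hm.linkThree_beside hA hB hr ihA hr'' hp' hq').rotate
        · exact (hm.linkThree_of_split hA hB hr ihA ihB hx hy hp hq).rotate
      · rcases hm.pair_cases hr' with hr'' | hr'' | ⟨x, hx, y, hy, rfl⟩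
        · exact (hm.linkThree_beside hA hB hr ihA hq' hr'' hp').rotate.rotate
        · exact hm.symm.linkThree_beside hB hA hr ihB hp' hq' hr''
        · exact (hm.linkThree_of_split hA hB hr ihA ihB hx hy hp hq).rotate
      · exact (hm.linkThree_of_split hA hB hr ihA ihB hx hy hr' hp).rotate.rotate
    · rcases hm.pair_cases hq with hq' | hq' | ⟨x, hx, y, hy, rfl⟩
      · rcases hm.pair_cases hr' with hr'' | hr'' | ⟨x, hx, y, hy, rfl⟩
        · exact hm.linkThree_beside hA hB hr ihA hp' hq' hr''
        · exact (hm.symm.linkThree_beside hB hA hr ihB hq' hr'' hp').rotate.rotate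
        · exact (hm.linkThree_of_split hA hB hr ihA ihB hx hy hp hq).rotate
      · rcases hm.pair_cases hr' with hr'' | hr'' | ⟨x, hx, y, hy, rfl⟩
        · exact (hm.symm.linkThree_beside hB hA hr ihB hr'' hp' hq').rotate
        · exact hm.symm.linkThree_inside hr ihB hp' hq' hr''
        · exact (hm.linkThree_of_split hA hB hr ihA ihB hx hy hp hq).rotate
      · exact (hm.linkThree_of_split hA hB hr ihA ihB hx hy hr' hp).rotate.rotate
    · exact hm.linkThree_of_split hA hB hr ihA ihB hx hy hq hr'

end RainbowLinkage

/-! ### Existence of the decomposition; paths -/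

namespace RainbowLinkage

variable {α β κ : Type*} [DecidableEq α] [DecidableEq β] [DecidableEq κ]

/-- By `cut_colours` both sides of a monochromatic cut again have one colour fewer than vertices, so
cutting can continue. Simplicity prevents two crossing edges from being parallel, as a double merge
requires. -/
theorem exists_cluster (ε : β → Sym2 α) (c : β → κ) (n : ℕ) : ∀ (V : Finset α) (E : Finset β),
    V.card = n → 1 ≤ n → (∀ e ∈ E, ∀ v ∈ ε e, v ∈ V) → RainbowAcyclic ε c E →
    (E.image c).card + 1 = V.card → (∀ s, (E.filter fun e => c e = s).card ≤ 2) →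
    (∀ e ∈ E, ∀ f ∈ E, ε e = ε f → e = f) → ∃ S k, Cluster ε c ⟨V, E, S, k⟩ := by
  induction n using Nat.strong_induction_on with
  | _ n ih =>
  intro V E hn h1 hV hac hcard hbd hsimple
  rcases h1.eq_or_lt with rfl | h2
  · obtain ⟨v, rfl⟩ := Finset.card_eq_one.mp hn
    have hE : E = ∅ := by
      have : (E.image c).card = 0 := by omega
      simpa using this
    subst hE
    exact ⟨∅, 0, Cluster.leaf v⟩
  obtain ⟨X, t, hXV, hXne, hYne, hcut⟩ :=
    exists_isMonochromaticCut c n ε V E hn h2 hV hac hcard hbd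
  have hunion : X ∪ (V \ X) = V := Finset.union_sdiff_of_subset hXV
  obtain ⟨hcX, hcY, htX, htY, hdisj, htE⟩ := hac.cut_colours (X := X) (Y := V \ X) (t := t)
    Finset.disjoint_sdiff hXne hYne (by rw [hunion]; exact hcard) (by
      intro x hx
      obtain ⟨f, hf, rfl⟩ := Finset.mem_image.mp hx
      by_cases hft : c f = t
      · exact Finset.mem_insert.mpr (Or.inl hft)
      refine Finset.mem_insert_of_mem (Finset.mem_union.mpr ?_)
      rcases hcut f hf hft with h | h
      · exact Or.inl (Finset.mem_image_of_mem c (mem_inside.mpr ⟨hf, h⟩))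
      · exact Or.inr (Finset.mem_image_of_mem c (mem_inside.mpr ⟨hf, h⟩)))
  have hcardV : X.card + (V \ X).card = V.card := by
    rw [← Finset.card_union_of_disjoint Finset.disjoint_sdiff, hunion]
  have hXpos := Finset.card_pos.mpr hXne
  have hYpos := Finset.card_pos.mpr hYne
  have sub : ∀ Z : Finset α, Z.card < n → 1 ≤ Z.card →
      ((inside ε E Z).image c).card + 1 = Z.card →
      ∃ S k, Cluster ε c ⟨Z, inside ε E Z, S, k⟩ := fun Z hZ hZ1 hZc =>
    ih Z.card hZ Z (inside ε E Z) rfl hZ1 (fun e he => (mem_inside.mp he).2)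
      (hac.subset inside_subset) hZc
      (fun s => (Finset.card_le_card (Finset.filter_subset_filter _ inside_subset)).trans (hbd s))
      (fun e he f hf => hsimple e (inside_subset he) f (inside_subset hf))
  obtain ⟨S, k, hX⟩ := sub X (by omega) (by omega) hcX
  obtain ⟨S', k', hY⟩ := sub (V \ X) (by omega) (by omega) hcY
  have hends : ∀ g ∈ E, c g = t → ∃ a ∈ X, ∃ b ∈ V \ X, ε g = s(a, b) := by
    intro g hg hgt
    obtain ⟨a, b, hab⟩ := exists_ends ε g
    have ha : a ∈ V := hV g hg a (by simp [hab])
    have hb : b ∈ V := hV g hg b (by simp [hab])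
    have h3 : ¬ (a ∈ X ∧ b ∈ X) := fun h => htX (hgt ▸ Finset.mem_image_of_mem c
      (mem_inside.mpr ⟨hg, by simpa [hab] using h⟩))
    have h4 : ¬ (a ∈ V \ X ∧ b ∈ V \ X) := fun h => htY (hgt ▸ Finset.mem_image_of_mem c
      (mem_inside.mpr ⟨hg, by
        rw [hab]
        simp only [Sym2.mem_iff, forall_eq_or_imp, forall_eq]
        exact h⟩))
    by_cases haX : a ∈ X
    · exact ⟨a, haX, b, Finset.mem_sdiff.mpr ⟨hb, fun hbX => h3 ⟨haX, hbX⟩⟩, hab⟩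
    · have haY : a ∈ V \ X := Finset.mem_sdiff.mpr ⟨ha, haX⟩
      have hbX : b ∈ X := by
        by_contra hbX
        exact h4 ⟨haY, Finset.mem_sdiff.mpr ⟨hb, hbX⟩⟩
      exact ⟨b, hbX, a, haY, hab.trans Sym2.eq_swap⟩
  have hEmem : ∀ g ∈ E, g ∈ inside ε E X ∨ g ∈ inside ε E (V \ X) ∨ c g = t := by
    intro g hg
    by_cases hgt : c g = t
    · exact Or.inr (Or.inr hgt)
    · rcases hcut g hg hgt with h | h
      · exact Or.inl (mem_inside.mpr ⟨hg, h⟩)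
      · exact Or.inr (Or.inl (mem_inside.mpr ⟨hg, h⟩))
  have build : ∀ e ∈ E, ∀ f ∈ E, c e = t → c f = t → (∀ g ∈ E, c g = t → g = e ∨ g = f) →
      ∃ S k, Cluster ε c ⟨V, E, S, k⟩ := by
    intro e he f hf het hft hall
    obtain ⟨a, ha, b, hb, hab⟩ := hends e he het
    have hcolX : ∀ g ∈ inside ε E X, c g ≠ c e := fun g hg h =>
      htX (het ▸ h ▸ Finset.mem_image_of_mem c hg)
    have hcolY : ∀ g ∈ inside ε E (V \ X), c g ≠ c e := fun g hg h =>
      htY (het ▸ h ▸ Finset.mem_image_of_mem c hg)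
    have hcolXY : ∀ g ∈ inside ε E X, ∀ h ∈ inside ε E (V \ X), c g ≠ c h := fun g hg h hh hgh =>
      Finset.disjoint_left.mp hdisj (Finset.mem_image_of_mem c hg)
        (hgh ▸ Finset.mem_image_of_mem c hh)
    have hEeq : E = insert e (insert f (inside ε E X ∪ inside ε E (V \ X))) := by
      ext g
      simp only [Finset.mem_insert, Finset.mem_union]
      constructor
      · intro hg
        rcases hEmem g hg with h | h | h
        · exact Or.inr (Or.inr (Or.inl h))
        · exact Or.inr (Or.inr (Or.inr h))
        · exact (hall g hg h).imp id Or.inl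
      · rintro (rfl | rfl | h | h)
        · exact he
        · exact hf
        · exact inside_subset h
        · exact inside_subset h
    by_cases hef : e = f
    · subst hef
      refine ⟨insert e (S ∪ S'), k + k' + 1, Cluster.merge hX hY (e := e) (f := e) (a := a) (b := b)
        (a' := a) (b' := b) ⟨hunion.symm, hEeq, Finset.disjoint_sdiff, hab, hab, ha, hb, ha, hb,
          rfl, hcolX, hcolY, hcolXY, Or.inl ⟨rfl, rfl, rfl, rfl, rfl⟩⟩⟩
    · obtain ⟨a', ha', b', hb', hab'⟩ := hends f hf hft
      refine ⟨S ∪ S', k + k', Cluster.merge hX hY (e := e) (f := f) (a := a) (b := b)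
        (a' := a') (b' := b') ⟨hunion.symm, hEeq, Finset.disjoint_sdiff, hab, hab', ha, hb, ha',
          hb', het.trans hft.symm, hcolX, hcolY, hcolXY, Or.inr ⟨hef, ?_, rfl, rfl⟩⟩⟩
      by_contra! hcon
      exact hef (hsimple e he f hf (by rw [hab, hab', hcon.1, hcon.2]))
  obtain ⟨e, he, het⟩ := Finset.mem_image.mp htE
  by_cases hother : ∃ f ∈ E, c f = t ∧ f ≠ e
  · obtain ⟨f, hf, hft, hfe⟩ := hother
    refine build e he f hf het hft fun g hg hgt => ?_
    by_contra! hcon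
    have hsub : ({e, f, g} : Finset β) ⊆ E.filter fun x => c x = t := by
      intro x hx
      simp only [Finset.mem_insert, Finset.mem_singleton] at hx
      rcases hx with rfl | rfl | rfl <;> simp [*]
    have := (Finset.card_le_card hsub).trans (hbd t)
    rw [Finset.card_eq_three.mpr ⟨e, f, g, hfe.symm, hcon.1.symm, hcon.2.symm, rfl⟩] at this
    omega
  · push Not at hother
    exact build e he e he het het fun g hg hgt => Or.inl (hother g hg hgt)

/-- Connected vertices are joined by a path. -/
theorem Conn.exists_path [Nonempty β] {ε : β → Sym2 α} {F : Finset β} {u v : α} (h : Conn ε F u v) :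
    ∃ (m : ℕ) (w : ℕ → α) (g : ℕ → β), w 0 = u ∧ w m = v ∧ Set.InjOn w (Set.Iic m) ∧
      Set.InjOn g (Set.Iio m) ∧ ∀ i < m, g i ∈ F ∧ ε (g i) = s(w i, w (i + 1)) := by
  have hwalk : ∃ (m : ℕ) (w : ℕ → α), w 0 = u ∧ w m = v ∧
      ∀ i < m, ∃ e ∈ F, ε e = s(w i, w (i + 1)) := by
    induction h with
    | refl => exact ⟨0, fun _ => u, rfl, rfl, by simp⟩
    | @tail x y _ hxy ih =>
      obtain ⟨m, w, h0, hm, hw⟩ := ih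
      refine ⟨m + 1, fun i => if i ≤ m then w i else y, by simp [h0], by simp, fun i hi => ?_⟩
      rcases Nat.lt_succ_iff_lt_or_eq.mp hi with hi | rfl
      · have h1 : i ≤ m := by omega
        have h2 : i + 1 ≤ m := by omega
        simpa [h1, h2] using hw i hi
      · simpa [hm] using hxy
  classical
  have hspec := Nat.find_spec hwalk
  have hmin := fun k (hk : k < Nat.find hwalk) => Nat.find_min hwalk hk
  generalize Nat.find hwalk = m at hspec hmin
  obtain ⟨w, h0, hm, hw⟩ := hspec
  -- In a shortest walk a repeated vertex would allow the segment between to be cut out.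
  have hlt : ∀ i j, i < j → j ≤ m → w i ≠ w j := by
    intro i j hij hj hwij
    refine hmin (m - (j - i)) (by omega) ⟨fun k => if k ≤ i then w k else w (k + (j - i)),
      by simp [h0], ?_, fun k hk => ?_⟩
    · dsimp only
      split_ifs with h1
      · rw [show m - (j - i) = i by omega, hwij, show j = m by omega, hm]
      · rw [show m - (j - i) + (j - i) = m by omega, hm]
    · dsimp only
      rcases lt_trichotomy k i with hki | rfl | hki
      · rw [if_pos (by omega), if_pos (by omega)]
        exact hw k (by omega)
      · rw [if_pos le_rfl, if_neg (by omega), hwij, show k + 1 + (j - k) = j + 1 by omega]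
        exact hw j (by omega)
      · rw [if_neg (by omega), if_neg (by omega),
          show k + 1 + (j - i) = k + (j - i) + 1 by omega]
        exact hw (k + (j - i)) (by omega)
  have hinj : Set.InjOn w (Set.Iic m) := by
    intro i hi j hj hij
    rcases lt_trichotomy i j with h | h | h
    · exact absurd hij (hlt i j h hj)
    · exact h
    · exact absurd hij.symm (hlt j i h hi)
  choose! g hgF hg using hw
  refine ⟨m, w, g, h0, hm, hinj, ?_, fun i hi => ⟨hgF i hi, hg i hi⟩⟩
  intro i hi j hj hij
  simp only [Set.mem_Iio] at hi hj
  have h1 := hg i hi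
  rw [hij, hg j hj] at h1
  rcases Sym2.eq_iff.mp h1 with ⟨h2, -⟩ | ⟨h2, h3⟩
  · exact (hinj (by simp; omega) (by simp; omega) h2).symm
  · have h4 := hinj (by simp; omega) (by simp; omega) h2
    have h5 := hinj (by simp; omega) (by simp; omega) h3
    omega

end RainbowLinkage

/-! ### Translation from `Graph` -/

namespace RainbowLinkage

variable {α β γ κ : Type*}

theorem isCycleEdgeSet_of_path (H : Graph α γ) {m : ℕ} {w : ℕ → α} {g : ℕ → γ} {e : γ}
    (hw : Set.InjOn w (Set.Iic m)) (hg : Set.InjOn g (Set.Iio m))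
    (hlink : ∀ i < m, H.IsLink (g i) (w i) (w (i + 1))) (he : ∀ i < m, g i ≠ e)
    (hclose : H.IsLink e (w m) (w 0)) : H.IsCycleEdgeSet (insert e (g '' Set.Iio m)) := by
  refine ⟨m, fun i => w i, fun i => if (i : ℕ) < m then g i else e, ?_, ?_, ?_, ?_⟩
  · intro i j hij
    exact Fin.ext (hw (Nat.lt_succ_iff.mp i.2) (Nat.lt_succ_iff.mp j.2) hij)
  · intro i j hij
    have hi := i.2
    have hj := j.2
    dsimp only at hij
    split_ifs at hij with h1 h2 h2
    · exact Fin.ext (hg h1 h2 hij)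
    · exact absurd hij (he i h1)
    · exact absurd hij.symm (he j h2)
    · exact Fin.ext (by omega)
  · intro i
    induction i using Fin.lastCases with
    | last => simpa using hclose
    | cast i =>
      rw [Fin.coeSucc_eq_succ]
      simpa using hlink i i.2
  · ext x
    simp only [Set.mem_insert_iff, Set.mem_image, Set.mem_Iio, Set.mem_range]
    constructor
    · rintro (rfl | ⟨i, hi, rfl⟩)
      · exact ⟨Fin.last m, by simp⟩
      · exact ⟨⟨i, by omega⟩, by simp [hi]⟩
    · rintro ⟨i, rfl⟩
      split_ifs with h
      · exact Or.inr ⟨i, h, rfl⟩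
      · exact Or.inl rfl

variable [DecidableEq α] [DecidableEq β]

theorem Conn.exists_cycle [Nonempty β] (H : Graph α γ) {φ : β → γ} (hφ : Function.Injective φ)
    {ε : β → Sym2 α} {F : Finset β} {u v : α} (h : Conn ε F u v)
    (hF : ∀ f ∈ F, ∀ a b, ε f = s(a, b) → H.IsLink (φ f) a b) {e : γ} (he : ∀ f ∈ F, φ f ≠ e)
    (hclose : H.IsLink e u v) :
    ∃ P ⊆ F, H.IsCycleEdgeSet (insert e (φ '' (P : Set β))) := by
  obtain ⟨m, w, g, rfl, rfl, hw, hg, hlink⟩ := h.exists_path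
  refine ⟨(Finset.range m).image g, ?_, ?_⟩
  · intro x hx
    obtain ⟨i, hi, rfl⟩ := Finset.mem_image.mp hx
    exact (hlink i (Finset.mem_range.mp hi)).1
  · have := isCycleEdgeSet_of_path H (g := φ ∘ g) (e := e) hw (hφ.comp_injOn hg)
      (fun i hi => hF _ (hlink i hi).1 _ _ (hlink i hi).2) (fun i hi => he _ (hlink i hi).1)
      hclose.symm
    rwa [Set.image_comp, ← Finset.coe_range, ← Finset.coe_image] at this

/-- A total end function turns contraction into `Sym2.map`; its values off the edge set are
arbitrary. -/
theorem exists_ends_of_graph [Nonempty α] (G : Graph α β) :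
    ∃ ε : β → Sym2 α, ∀ e ∈ G.edgeSet, ∀ u v, G.IsLink e u v ↔ ε e = s(u, v) := by
  have : ∀ e, ∃ p : Sym2 α, e ∈ G.edgeSet → ∀ u v, G.IsLink e u v ↔ p = s(u, v) := by
    intro e
    by_cases he : e ∈ G.edgeSet
    · obtain ⟨a, b, hab⟩ := G.exists_isLink_of_mem_edgeSet he
      exact ⟨s(a, b), fun _ u v => hab.isLink_iff_sym2_eq⟩
    · exact ⟨s(Classical.arbitrary α, Classical.arbitrary α), fun h => absurd h he⟩
  choose ε hε using this
  exact ⟨ε, fun e he => hε e he⟩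

theorem rainbowAcyclic_of_circuitAchromatic {κ : Type*} {G : Graph α β} {c : β → κ}
    {ε : β → Sym2 α} (hε : ∀ e ∈ G.edgeSet, ∀ u v, G.IsLink e u v ↔ ε e = s(u, v)) {E : Finset β}
    (hE : (E : Set β) ⊆ G.edgeSet) (h : G.CircuitAchromatic c) : RainbowAcyclic ε c E := by
  intro F hF hinj e he u v huv hconn
  have : Nonempty β := ⟨e⟩
  obtain ⟨P, hP, hcyc⟩ := hconn.exists_cycle G Function.injective_id
    (fun f hf a b hab => (hε f (hE (hF (Finset.mem_of_mem_erase hf))) a b).mpr hab)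
    (fun f hf => Finset.ne_of_mem_erase hf) ((hε e (hE (hF he)) u v).mpr huv)
  refine h _ ⟨hcyc, hinj.mono ?_⟩
  rw [Set.image_id]
  exact Set.insert_subset he fun x hx => Finset.mem_of_mem_erase (hP hx)

/-- The singular edges give `k` colours; the other `2 * (n - 1) - 2 * k` edges lie in classes of
size at most two and give at least `n - 1 - k` more. -/
theorem card_image_colours {G : Graph α β} {c : β → ℕ} {E : Finset β}
    (hE : (E : Set β) = G.edgeSet) {n k : ℕ} (hm : E.card + k = 2 * (n - 1))
    (hbd : ∀ s, (E.filter fun e => c e = s).card ≤ 2) (hA : (G.colourSingularEdges c).ncard = k) :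
    n - 1 ≤ (E.image c).card := by
  classical
  have hmem : ∀ e, e ∈ E ↔ e ∈ G.edgeSet := fun e => by rw [← hE]; simp
  set S := E.filter fun e => ∀ f ∈ E, c f = c e → f = e with hS
  have hSA : (S : Set β) = G.colourSingularEdges c := by
    ext e
    simp [hS, Graph.colourSingularEdges, hmem]
  have hSk : S.card = k := by rw [← hA, ← hSA, Set.ncard_coe_finset]
  have hSE : S ⊆ E := Finset.filter_subset _ _
  have h1 : (S.image c).card = S.card := Finset.card_image_of_injOn fun e he f hf hef =>
    (Finset.mem_filter.mp hf).2 e (hSE he) hef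
  have h2 : (E \ S).card ≤ 2 * ((E \ S).image c).card :=
    Finset.card_le_mul_card_image _ _ fun s _ => (Finset.card_le_card
      (Finset.filter_subset_filter _ Finset.sdiff_subset)).trans (hbd s)
  have h3 : Disjoint (S.image c) ((E \ S).image c) := by
    rw [Finset.disjoint_left]
    intro s hs hs'
    obtain ⟨e, he, rfl⟩ := Finset.mem_image.mp hs
    obtain ⟨f, hf, hfe⟩ := Finset.mem_image.mp hs'
    rw [Finset.mem_sdiff] at hf
    have := (Finset.mem_filter.mp he).2 f hf.1 hfe
    exact hf.2 (this ▸ he)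
  have h4 : (S.image c ∪ (E \ S).image c).card ≤ (E.image c).card :=
    Finset.card_le_card (Finset.union_subset (Finset.image_subset_image hSE)
      (Finset.image_subset_image Finset.sdiff_subset))
  rw [Finset.card_union_of_disjoint h3] at h4
  have h5 := Finset.card_sdiff_add_card_eq_card hSE
  omega

/-- A star of three edges from `o` to the vertices of the added triangle forms a `K₄` with it. -/
theorem isKFour_of_star {G : Graph α β} (hsimple : G.Simple) {x : Fin 3 → α}
    (hx : Function.Injective x) {o : α} {g : Fin 3 → β} (hg : ∀ i, G.IsLink (g i) o (x i)) :
    ((G.addTriangle x).edgeInduce (Graph.triangleEdges β ∪ Sum.inl '' Set.range g)).IsKFour := by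
  have ho : ∀ i, o ≠ x i := fun i => (hg i).ne
  set F : Set (β ⊕ Fin 3) := Graph.triangleEdges β ∪ Sum.inl '' Set.range g with hF
  have hFr : ∀ i, Sum.inr i ∈ F := fun i => Or.inl ⟨i, rfl⟩
  have hFl : ∀ i, Sum.inl (g i) ∈ F := fun i => Or.inr ⟨g i, ⟨i, rfl⟩, rfl⟩
  have hgF : ∀ b, Sum.inl b ∈ F → ∃ i, g i = b := by
    rintro b (⟨i, hi⟩ | ⟨b', ⟨i, rfl⟩, hb⟩)
    · exact absurd hi (by simp)
    · exact ⟨i, by simpa using hb⟩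
  have hne : ∀ i : Fin 3, i ≠ i + 1 := by decide
  have hcyc : ∀ i j : Fin 3, i ≠ j → j = i + 1 ∨ i = j + 1 := by decide
  have hinr : ∀ i u v, ((G.addTriangle x).edgeInduce F).IsLink (Sum.inr i) u v ↔
      s(u, v) = s(x i, x (i + 1)) := fun i u v => ⟨fun h => h.2, fun h => ⟨hFr i, h⟩⟩
  have hinl : ∀ b u v, ((G.addTriangle x).edgeInduce F).IsLink (Sum.inl b) u v →
      G.IsLink b u v ∧ ∃ i, g i = b := fun b u v h => ⟨h.2, hgF b h.1⟩
  -- Star edges contain `o` and triangle edges do not, so the two kinds are never parallel.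
  have hmix : ∀ i b u v, s(u, v) = s(x i, x (i + 1)) → G.IsLink b u v → (∃ j, g j = b) →
      False := by
    rintro i b u v h1 h2 ⟨j, rfl⟩
    have h3 := (hg j).isLink_iff_sym2_eq.mp h2
    rw [h1] at h3
    rcases Sym2.eq_iff.mp h3 with ⟨h4, -⟩ | ⟨h4, -⟩
    · exact ho _ h4
    · exact ho _ h4
  have hS : ((G.addTriangle x).edgeInduce F).Simple := by
    refine { not_isLoopAt := ?_, eq_of_isLink := ?_ }
    · rintro (b | i) u h
      · exact (hinl b u u h).1.ne rfl
      · have := (hinr i u u).mp h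
        rcases Sym2.eq_iff.mp this with ⟨h1, h2⟩ | ⟨h1, h2⟩
        · exact hne i (hx (h1.symm.trans h2))
        · exact hne i (hx (h2.symm.trans h1))
    · rintro (b | i) (b' | j) u v h h'
      · exact congrArg _ ((hinl b u v h).1.eq (hinl b' u v h').1)
      · exact (hmix j b u v ((hinr j u v).mp h') (hinl b u v h).1 (hinl b u v h).2).elim
      · exact (hmix i b' u v ((hinr i u v).mp h) (hinl b' u v h').1 (hinl b' u v h').2).elim
      · have h1 := ((hinr i u v).mp h).symm.trans ((hinr j u v).mp h')
        rw [Sym2.eq_iff] at h1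
        have h2 : (i = j ∧ i + 1 = j + 1) ∨ (i = j + 1 ∧ i + 1 = j) :=
          h1.imp (And.imp (fun h => hx h) (fun h => hx h))
            (And.imp (fun h => hx h) (fun h => hx h))
        have h3 : ∀ i j : Fin 3, ((i = j ∧ i + 1 = j + 1) ∨ (i = j + 1 ∧ i + 1 = j)) → i = j := by
          decide
        rw [h3 i j h2]
  refine ⟨hS, ?_⟩
  set w : Fin 4 → α := Fin.cons o x with hw
  have hwinj : Function.Injective w := by
    rw [hw, Fin.cons_injective_iff]
    exact ⟨fun ⟨i, hi⟩ => ho i hi.symm, hx⟩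
  have hadj : ∀ i j, i ≠ j → ((G.addTriangle x).edgeInduce F).Adj (w i) (w j) := by
    intro i j hij
    induction i using Fin.cases with
    | zero =>
      induction j using Fin.cases with
      | zero => exact absurd rfl hij
      | succ j => exact ⟨Sum.inl (g j), hFl j, hg j⟩
    | succ i =>
      induction j using Fin.cases with
      | zero => exact ⟨Sum.inl (g i), hFl i, (hg i).symm⟩
      | succ j =>
        rcases hcyc i j (fun h => hij (by rw [h])) with rfl | rfl
        · exact ⟨Sum.inr i, (hinr _ _ _).mpr rfl⟩
        · exact ⟨Sum.inr j, (hinr _ _ _).mpr Sym2.eq_swap⟩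
  have hV : ∀ v, v ∈ ((G.addTriangle x).edgeInduce F).vertexSet ↔ ∃ i, w i = v := by
    intro v
    constructor
    · rintro ⟨(b | i), he, y, hy⟩
      · obtain ⟨i, rfl⟩ := hgF b he
        have hy' : G.IsLink (g i) v y := hy
        rcases hy'.left_eq_or_eq (hg i) with rfl | rfl
        · exact ⟨0, rfl⟩
        · exact ⟨i.succ, rfl⟩
      · have hy' : s(v, y) = s(x i, x (i + 1)) := hy
        rcases Sym2.eq_iff.mp hy' with ⟨rfl, -⟩ | ⟨rfl, -⟩
        · exact ⟨i.succ, rfl⟩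
        · exact ⟨(i + 1).succ, rfl⟩
    · rintro ⟨i, rfl⟩
      have h3 : ∀ i : Fin 4, ∃ j, i ≠ j := by decide
      obtain ⟨j, hj⟩ := h3 i
      exact (hadj i j hj).left_mem
  let φ : Fin 4 ≃ ((G.addTriangle x).edgeInduce F).vertexSet :=
    Equiv.ofBijective (fun i => ⟨w i, (hV _).mpr ⟨i, rfl⟩⟩)
      ⟨fun i j hij => hwinj (congrArg Subtype.val hij), fun ⟨v, hv⟩ => by
        obtain ⟨i, rfl⟩ := (hV v).mp hv
        exact ⟨i, rfl⟩⟩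
  refine ⟨RelIso.symm ⟨φ, ?_⟩⟩
  intro i j
  constructor
  · intro h hij
    exact h.1 (by rw [hij])
  · intro h
    exact ⟨fun hij => h (φ.injective hij), hadj i j h⟩

end RainbowLinkage

/-! ### Rainbow cycles through the added triangle -/

namespace RainbowLinkage

variable {α β : Type*} [DecidableEq α] [DecidableEq β]

theorem exists_rainbowCycle [Nonempty β] {G : Graph α β} {c : β → ℕ} {n : ℕ} {ε : β → Sym2 α}
    (hε : ∀ e ∈ G.edgeSet, ∀ u v, G.IsLink e u v ↔ ε e = s(u, v)) {E : Finset β}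
    (hE : (E : Set β) = G.edgeSet) (hc : ∀ e ∈ E, c e ≠ n) {x : Fin 3 → α} {i : Fin 3} {u v : α}
    (huv : s(u, v) = s(x i, x (i + 1))) {P : Finset β} (hP : RainbowConn ε c E u v P) :
    ∃ Q ⊆ P, (G.addTriangle x).IsRainbowCycle (Graph.extendColouring c n)
      (insert (Sum.inr i) (Sum.inl '' (Q : Set β))) := by
  have hEm : ∀ e ∈ E, e ∈ G.edgeSet := fun e he => by rw [← hE]; exact he
  obtain ⟨Q, hQ, hcyc⟩ := hP.2.2.exists_cycle (G.addTriangle x) (φ := Sum.inl)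
    Sum.inl_injective (fun f hf a b hab => (hε f (hEm f (hP.1 hf)) a b).mpr hab)
    (e := Sum.inr i) (by simp) huv
  refine ⟨Q, hQ, hcyc, ?_⟩
  rintro y (rfl | ⟨b, hb, rfl⟩) z (rfl | ⟨b', hb', rfl⟩) hyz
  · rfl
  · exact absurd hyz.symm (hc b' (hP.1 (hQ hb')))
  · exact absurd hyz (hc b (hP.1 (hQ hb)))
  · exact congrArg _ (hP.2.1 (hQ hb) (hQ hb') hyz)

theorem ncard_insert_inr (Q : Finset β) (i : Fin 3) :
    (insert (Sum.inr i) (Sum.inl '' (Q : Set β)) : Set (β ⊕ Fin 3)).ncard = Q.card + 1 := by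
  rw [Set.ncard_insert_of_notMem (by simp) (Q.finite_toSet.image _),
    Set.ncard_image_of_injective _ Sum.inl_injective, Set.ncard_coe_finset]

theorem ncard_insert_inr_inter (Q : Finset β) (i : Fin 3) :
    ((insert (Sum.inr i) (Sum.inl '' (Q : Set β)) : Set (β ⊕ Fin 3)) ∩
      Graph.triangleEdges β).ncard = 1 := by
  rw [Set.ncard_eq_one]
  refine ⟨Sum.inr i, ?_⟩
  ext y
  constructor
  · rintro ⟨rfl | ⟨b, -, rfl⟩, j, hj⟩
    · rfl
    · simp at hj
  · rintro rfl
    exact ⟨Or.inl rfl, i, rfl⟩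

theorem exists_disjoint_rainbowCycles [Nonempty β] {G : Graph α β} {c : β → ℕ} {n : ℕ}
    {ε : β → Sym2 α} (hε : ∀ e ∈ G.edgeSet, ∀ u v, G.IsLink e u v ↔ ε e = s(u, v)) {E : Finset β}
    (hE : (E : Set β) = G.edgeSet) (hc : ∀ e ∈ E, c e ≠ n) {x : Fin 3 → α} (i : Fin 3)
    (h : Linked ε c E s(x i, x i) s(x (i + 1), x (i + 2)) n) :
    ∃ C₁ C₂ : Set (β ⊕ Fin 3),
      (G.addTriangle x).IsRainbowCycle (Graph.extendColouring c n) C₁ ∧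
      (G.addTriangle x).IsRainbowCycle (Graph.extendColouring c n) C₂ ∧
      Disjoint C₁ C₂ ∧
      (C₁ ∩ Graph.triangleEdges β).ncard = 1 ∧
      (C₂ ∩ Graph.triangleEdges β).ncard = 1 ∧
      C₁.ncard + C₂.ncard ≤ n + 2 := by
  have hi3 : ∀ i : Fin 3, i + 2 + 1 = i := by decide
  have hi2 : ∀ i : Fin 3, i ≠ i + 2 := by decide
  obtain ⟨u, v, huv, P, Q, hP, hQ, hPQ, hn⟩ := h.exists_link
  obtain ⟨rfl, rfl⟩ : x i = u ∧ x i = v := by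
    rcases Sym2.eq_iff.mp huv with h | h
    exacts [h, h.symm]
  obtain ⟨P', hP', hcP⟩ := exists_rainbowCycle hε hE hc (x := x) (i := i) rfl hP
  -- The new edge between `x (i + 2)` and `x i` has index `i + 2`, since `i + 2 + 1 = i` in `Fin 3`.
  obtain ⟨Q', hQ', hcQ⟩ := exists_rainbowCycle hε hE hc (x := x) (i := i + 2)
    (by rw [hi3 i, Sym2.eq_swap]) hQ
  refine ⟨_, _, hcP, hcQ, ?_, ncard_insert_inr_inter _ _, ncard_insert_inr_inter _ _, ?_⟩
  · rw [Set.disjoint_left]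
    rintro y (rfl | ⟨b, hb, rfl⟩) (hy | ⟨b', hb', hy⟩)
    · exact hi2 i (Sum.inr_injective hy)
    · simp at hy
    · simp at hy
    · obtain rfl : b' = b := by simpa using hy
      exact Finset.disjoint_left.mp hPQ (hP' hb) (hQ' hb')
  · rw [ncard_insert_inr, ncard_insert_inr]
    have h1 := Finset.card_le_card hP'
    have h2 := Finset.card_le_card hQ'
    omega

theorem finite_edgeSet_of_simple {G : Graph α β} (hsimple : G.Simple) (hfin : G.vertexSet.Finite)
    {ε : β → Sym2 α} (hε : ∀ e ∈ G.edgeSet, ∀ u v, G.IsLink e u v ↔ ε e = s(u, v)) :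
    G.edgeSet.Finite := by
  refine Set.Finite.of_injOn (f := ε) (t := (fun z : α × α => s(z.1, z.2)) ''
    (G.vertexSet ×ˢ G.vertexSet)) ?_ ?_ ((hfin.prod hfin).image _)
  · intro e he
    obtain ⟨a, b, hab⟩ := G.exists_isLink_of_mem_edgeSet he
    exact ⟨(a, b), ⟨hab.left_mem, hab.right_mem⟩, ((hε e he a b).mp hab).symm⟩
  · intro e he f hf hef
    obtain ⟨a, b, hab⟩ := G.exists_isLink_of_mem_edgeSet he
    exact hab.eq ((hε f hf a b).mpr (hef ▸ (hε e he a b).mp hab))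

end RainbowLinkage

/-! ### The theorem -/

open RainbowLinkage in
theorem theorem7p1 {α β : Type*} (G : Graph α β) (n k : ℕ) (c : β → ℕ) (x : Fin 3 → α)
    (hk : 1 ≤ k ∧ k ≤ 3)
    (hsimple : G.Simple)
    (hfin : G.vertexSet.Finite)
    (hn : G.vertexSet.ncard = n)
    (hm : G.edgeSet.ncard + k = 2 * (n - 1))
    (hc : G.IsEdgeColouring (n - 1) c)
    (hbdd : G.IsBoundedColouring 2 c)
    (hachr : G.CircuitAchromatic c)
    (hA : (G.colourSingularEdges c).ncard = k)
    (hxV : ∀ i, x i ∈ G.vertexSet)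
    (hx : Function.Injective x)
    (hK4 : ¬ ((G.addTriangle x).edgeInduce
      (Graph.triangleEdges β ∪ Sum.inl '' G.colourSingularEdges c)).IsKFour) :
    ∃ C₁ C₂ : Set (β ⊕ Fin 3),
      (G.addTriangle x).IsRainbowCycle (Graph.extendColouring c n) C₁ ∧
      (G.addTriangle x).IsRainbowCycle (Graph.extendColouring c n) C₂ ∧
      Disjoint C₁ C₂ ∧
      (C₁ ∩ Graph.triangleEdges β).ncard = 1 ∧
      (C₂ ∩ Graph.triangleEdges β).ncard = 1 ∧
      C₁.ncard + C₂.ncard ≤ n + 2 := by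
  classical
  have : Nonempty α := ⟨x 0⟩
  obtain ⟨ε, hε⟩ := exists_ends_of_graph G
  have hfinE := finite_edgeSet_of_simple hsimple hfin hε
  obtain ⟨V, hV⟩ := hfin.exists_finset_coe
  obtain ⟨E, hE⟩ := hfinE.exists_finset_coe
  have hEm : ∀ e, e ∈ E ↔ e ∈ G.edgeSet := fun e => by rw [← hE]; simp
  have hVm : ∀ v, v ∈ V ↔ v ∈ G.vertexSet := fun v => by rw [← hV]; simp
  rw [← hV, Set.ncard_coe_finset] at hn
  rw [← hE, Set.ncard_coe_finset] at hm
  obtain ⟨e₀, he₀⟩ : (G.colourSingularEdges c).Nonempty := by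
    rw [Set.nonempty_iff_ne_empty]
    intro h0
    rw [h0, Set.ncard_empty] at hA
    omega
  have : Nonempty β := ⟨e₀⟩
  have hnpos : 1 ≤ n := hn ▸ Finset.card_pos.mpr ⟨x 0, (hVm _).mpr (hxV 0)⟩
  have hcE : ∀ e ∈ E, 1 ≤ c e ∧ c e ≤ n - 1 := fun e he => hc ((hEm e).mp he)
  have hends : ∀ e ∈ E, ∀ v ∈ ε e, v ∈ V := by
    rintro e he v ⟨w, hw⟩
    exact (hVm v).mpr ((hε e ((hEm e).mp he) v w).mpr hw).left_mem
  have hbd : ∀ s, (E.filter fun e => c e = s).card ≤ 2 := by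
    intro s
    have h1 := hbdd s
    have h2 : {e | e ∈ G.edgeSet ∧ c e = s} = ((E.filter fun e => c e = s : Finset β) : Set β) := by
      ext e
      simp [hEm]
    rw [h2, Set.encard_coe_eq_coe_finsetCard] at h1
    exact_mod_cast h1
  have hac : RainbowAcyclic ε c E := rainbowAcyclic_of_circuitAchromatic hε hE.le hachr
  have hcol : (E.image c).card + 1 = V.card := by
    have h1 := card_image_colours hE hm hbd hA
    have h2 := hac.card_lt hends ⟨x 0, (hVm _).mpr (hxV 0)⟩
    omega
  obtain ⟨S, r, hcl⟩ := exists_cluster ε c n V E hn hnpos hends hac hcol hbd (by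
    intro e he f hf hef
    obtain ⟨a, b, hab⟩ := exists_ends ε e
    exact ((hε e ((hEm e).mp he) a b).mpr hab).eq
      ((hε f ((hEm f).mp hf) a b).mpr (hef ▸ hab)))
  have hr : r = k := by
    have := hcl.card_edges
    dsimp only at this
    omega
  have hcn : ∀ e ∈ E, c e ≠ n := fun e he h => by
    have := hcE e he
    omega
  have hxm : ∀ i, ∀ v ∈ s(x i, x i), v ∈ V := fun i v hv => by
    have : v = x i := by simpa using hv
    exact this ▸ (hVm _).mpr (hxV i)
  -- For degenerate pairs the bound `|V| + diagonal p - 1` is exactly `n`.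
  rcases hcl.linkThree (by dsimp only; omega) _ _ _ (hxm 0) (hxm 1) (hxm 2) with
    (⟨y, hy, z, hz, hl⟩ | ⟨y, hy, z, hz, hl⟩ | ⟨y, hy, z, hz, hl⟩) |
    ⟨o, x₀, x₁, x₂, hx₀, hx₁, hx₂, g₀, hg₀, g₁, hg₁, g₂, hg₂, h₀, h₁, h₂⟩
  · obtain rfl : y = x 1 := by simpa using hy
    obtain rfl : z = x 2 := by simpa using hz
    rw [diagonal_self] at hl
    exact exists_disjoint_rainbowCycles hε hE hcn 0 (hl.mono subset_rfl hn.le)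
  · obtain rfl : y = x 2 := by simpa using hy
    obtain rfl : z = x 0 := by simpa using hz
    rw [diagonal_self] at hl
    exact exists_disjoint_rainbowCycles hε hE hcn 1 (hl.mono subset_rfl hn.le)
  · obtain rfl : y = x 0 := by simpa using hy
    obtain rfl : z = x 1 := by simpa using hz
    rw [diagonal_self] at hl
    exact exists_disjoint_rainbowCycles hε hE hcn 2 (hl.mono subset_rfl hn.le)
  · obtain rfl : x 0 = x₀ := by simpa using hx₀
    obtain rfl : x 1 = x₁ := by simpa using hx₁
    obtain rfl : x 2 = x₂ := by simpa using hx₂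
    have hSE : ∀ g ∈ S, g ∈ E := fun g hg => hcl.singular_subset hg
    have hSA : ∀ g ∈ S, g ∈ G.colourSingularEdges c := fun g hg =>
      ⟨(hEm g).mp (hSE g hg), fun f hf hfg => hcl.eq_of_mem_singular hg ((hEm f).mpr hf) hfg⟩
    have hgS : ∀ i, ![g₀, g₁, g₂] i ∈ S := by
      intro i
      fin_cases i
      exacts [hg₀, hg₁, hg₂]
    have hgε : ∀ i, ε (![g₀, g₁, g₂] i) = s(o, x i) := by
      intro i
      fin_cases i
      exacts [h₀, h₁, h₂]
    have hinj : Function.Injective ![g₀, g₁, g₂] := by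
      intro i j hij
      by_contra hne
      exact TwoStar.edges_ne (fun h => hne (hx h)) (hgε i) (hgε j) hij
    -- Three distinct singular edges exhaust a set of `k ≤ 3` edges.
    have hAeq : Set.range ![g₀, g₁, g₂] = G.colourSingularEdges c := by
      refine Set.eq_of_subset_of_ncard_le ?_ ?_ (hfinE.subset fun e he => he.1)
      · rintro _ ⟨i, rfl⟩
        exact hSA _ (hgS i)
      · rw [hA, ← Set.image_univ, Set.ncard_image_of_injective _ hinj, Set.ncard_univ,
          Nat.card_fin]
        exact hk.2
    refine absurd ?_ hK4
    rw [← hAeq]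
    exact isKFour_of_star hsimple hx fun i =>
      (hε _ ((hEm _).mp (hSE _ (hgS i))) o (x i)).mpr (hgε i)
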